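/- **Setting.** Let $(\Omega,\mathcal F,\mathbb P)$ be a complete probability space with a filtration $(\mathcal F_t)_{t\ge 0}$ satisfying the usual conditions, $U$ a topological space homeomorphic to a Borel subset of $\mathbb R$, $\mathcal A$ a ring of Borel subsets of $U$, and $X$ a real Banach space with separable dual $X^*$. Let $\mathrm{Bil}(X^*,X^*)$ be the Banach space of bounded real bilinear forms on $X^*\times X^*$. For real càdlàg square integrable martingales $Y,Z$, $\langle Y,Z\rangle$ denotes the predictable quadratic covariation: the predictable right-continuous process of finite variation, null at $0$, unique up to indistinguishability, such that $YZ-\langle Y,Z\rangle$ is a martingale. Put $\langle Y\rangle=\langle Y,Y\rangle$ and $\langle Y,Z\rangle_s^t=\langle Y,Z\rangle_t-\langle Y,Z\rangle_s$. Let $M=(M(t,A):t\ge 0,A\in\mathcal A)$ be a cylindrical orthogonal martingale-valued measure, i.e. each $M(t,A):X^*\to L^0(\Omega,\mathcal F,\mathbb P)$ is linear and continuous (convergence in probability) and, for all $x^*\in X^*$: (i) $M(0,A)(x^*)=0$ a.s. for $A\in\mathcal A$; (ii) $M(A)(x^*)=(M(t,A)(x^*))_{t\ge0}$ is a real càdlàg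 mean-zero square integrable martingale for $A\in\mathcal A$; (iii) for $t>0$, $N=M(t,\cdot)(x^*)$ is a $\sigma$-finite $L^2$-valued measure: it is finitely additive a.s. with values in $L^2$, and there are Borel sets $U_n\uparrow U$ with $\mathcal B(U_n)\subseteq\mathcal A$ such that $\sup_{A\in\mathcal B(U_n)}\mathbb E|N(A)|^2<\infty$, $\mathbb E|N(A_j)|^2\to0$ whenever $A_j\in\mathcal B(U_n)$ decrease to $\emptyset$, and $N(A\cap U_n)\to N(A)$ in $L^2$ for all $A\in\mathcal A$; (iv) $\langle M(A)(x^*),M(B)(x^*)\rangle=0$ for disjoint $A,B\in\mathcal A$. For $x^*\in X^*$ let $\nu_{x^*}$ be the intensity measure of $M(\cdot)(x^*)$: the a.s. unique $\sigma$-finite random measure on $\mathcal B(\mathbb R_+)\otimes\mathcal B(U)$ that is predictable (the process $t\mapsto\nu_{x^*}([0,t]\times A)$ is predictable for each $A\in\mathcal B(U)$) and satisfies $\nu_{x^*}([0,t]\times A)=\langle M(A)(x^*)\rangle_t$ a.s. for all $t\ge0$, $A\in\mathcal A$. Assume that * $M$ has a quadratic variation $[M]$: a random measure on $\mathcal B(\mathbb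 R_+)\otimes\mathcal B(U)$ with $[M]([0,t]\times A)<\infty$ a.s. for each $t\ge 0$, $A\in\mathcal A$, which is minimal, for the a.s. order, among the random measures $\zeta$ such that for every $\|x^*\|=1$, $\nu_{x^*}\le\zeta$ a.s.; * $(\nu_{x^*})$ has the sequential boundedness property: for every sequence $(x_n^*)$ in the unit sphere of $X^*$ that is dense in it, every $\|x^*\|=1$ and $t>0$, a.s. $\nu_{x^*}((s,t]\times A)\le\sup_n\nu_{x^*_n}((s,t]\times A)$ for all $0\le s<t$, $A\in\mathcal A$. Given versions of the $\nu_{x^*}$, put $$\alpha_M(\omega)(C)(x^*,y^*)=\tfrac14\bigl(\nu_{x^*+y^*}(\omega)(C)-\nu_{x^*-y^*}(\omega)(C)\bigr)$$ for measurable $C$, whenever both terms are finite. **Theorem.** The intensity measures $\nu_{x^*}$, $x^*\in X^*$, have versions (each a.s. equal, as a measure, to the given one) for which the following holds. 1. For $\mathbb P$-a.e. $\omega$, for all $0\le s\le t$ and all $A\in\mathcal A$ with $[M](\omega)((s,t]\times A)<\infty$ (for each fixed rectangle this holds a.s.), $\nu_{x^*}(\omega)((s,t]\times A)<\infty$ for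 every $x^*\in X^*$, $\alpha_M(\omega)((s,t]\times A)$ is a bounded bilinear form on $X^*$, and $$\|\alpha_M(\omega)((s,t]\times A)\|_{\mathrm{Bil}(X^*,X^*)}\le[M](\omega)((s,t]\times A).$$ 2. Let $T>0$ and assume $\sup_{A\in\mathcal A}[M](\omega)([0,T]\times A)<\infty$ for $\mathbb P$-a.e. $\omega$. Then there is a random $\mathrm{Bil}(X^*,X^*)$-valued measure $\alpha$ on $\mathcal B([0,T])\otimes\mathcal B(U)$ (each $\alpha(\omega)$ is countably additive in the norm of $\mathrm{Bil}(X^*,X^*)$, and $\omega\mapsto\alpha(\omega)(C)(x^*,y^*)$ is measurable for all $C,x^*,y^*$) which extends $\alpha_M$: for $\mathbb P$-a.e. $\omega$, all $\nu_{x^*}(\omega)$ are finite on $[0,T]\times U$, and $\alpha(\omega)(C)(x^*,y^*)=\alpha_M(\omega)(C)(x^*,y^*)$ for all $C\in\mathcal B([0,T])\otimes\mathcal B(U)$ and $x^*,y^*\in X^*$. Moreover, for all $x^*,y^*\in X^*$, $A\in\mathcal A$ and $0\le s\le t\le T$, the covariation $\langle M(A)(x^*),M(A)(y^*)\rangle$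 exists and $$\alpha(\omega)((s,t]\times A)(x^*,y^*)=\langle M(A)(x^*),M(A)(y^*)\rangle_s^t(\omega)\qquad\text{for }\mathbb P\text{-a.e. }\omega.$$ -/

import Mathlib

open MeasureTheory Filter Topology Set
open scoped NNReal ENNReal

set_option maxSynthPendingDepth 3

noncomputable section

namespace CylMVM

/-- `U` is a Lusin space: homeomorphic to a Borel subset of the real line. -/
def IsLusin (U : Type*) [TopologicalSpace U] : Prop :=
  ∃ S : Set ℝ, MeasurableSet S ∧ Nonempty (U ≃ₜ S)

/-- Right-continuous with left limits. -/
def IsCadlagPath (f : ℝ≥0 → ℝ) : Prop :=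
  (∀ t, ContinuousWithinAt f (Ici t) t) ∧ ∀ t, ∃ l : ℝ, Tendsto f (𝓝[<] t) (𝓝 l)

/-- Real-valued, mean-zero, square integrable càdlàg martingales on `[0, ∞)`. -/
structure IsL2Martingale {Ω : Type*} [mΩ : MeasurableSpace Ω] (P : Measure Ω)
    (𝓕 : Filtration ℝ≥0 mΩ) (Y : ℝ≥0 → Ω → ℝ) : Prop where
  martingale : Martingale Y 𝓕 P
  memLp : ∀ t, MemLp (Y t) 2 P
  mean_zero : ∀ t, ∫ ω, Y t ω ∂P = 0
  cadlag : ∀ᵐ ω ∂P, IsCadlagPath fun t => Y t ω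

/-- `V` is (a version of) the predictable quadratic covariation `⟨Y, Z⟩`: a predictable,
right-continuous process of locally finite variation, null at time `0`, such that `Y Z - V` is a
martingale. For square integrable martingales `Y`, `Z` such a process exists and is unique up to
indistinguishability. -/
structure IsQuadCov {Ω : Type*} [mΩ : MeasurableSpace Ω] (P : Measure Ω)
    (𝓕 : Filtration ℝ≥0 mΩ) (Y Z V : ℝ≥0 → Ω → ℝ) : Prop where
  predictable : IsStronglyPredictable 𝓕 V
  zero : ∀ᵐ ω ∂P, V 0 ω = 0
  rightCont : ∀ᵐ ω ∂P, ∀ t, ContinuousWithinAt (fun r => V r ω) (Ici t) t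
  finiteVariation : ∀ᵐ ω ∂P, LocallyBoundedVariationOn (fun r => V r ω) univ
  martingale : Martingale (fun t ω => Y t ω * Z t ω - V t ω) 𝓕 P

/-- A `σ`-finite `L²(Ω)`-valued measure on the ring `𝒜` of Borel subsets of `U`. -/
structure IsSigmaFiniteL2Measure {Ω U : Type*} [MeasurableSpace Ω] [MeasurableSpace U]
    (P : Measure Ω) (𝒜 : Set (Set U)) (N : Set U → Ω → ℝ) : Prop where
  memLp : ∀ A ∈ 𝒜, MemLp (N A) 2 P
  additive : ∀ A ∈ 𝒜, ∀ B ∈ 𝒜, Disjoint A B → ∀ᵐ ω ∂P, N (A ∪ B) ω = N A ω + N B ω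
  sigmaFinite : ∃ E : ℕ → Set U, Monotone E ∧ (⋃ n, E n) = univ ∧ (∀ n, MeasurableSet (E n)) ∧
    (∀ n, ∀ B, MeasurableSet B → B ⊆ E n → B ∈ 𝒜) ∧
    (∀ n, ∃ c : ℝ, ∀ B, MeasurableSet B → B ⊆ E n → ∫ ω, (N B ω) ^ 2 ∂P ≤ c) ∧
    (∀ n, ∀ B : ℕ → Set U, (∀ j, MeasurableSet (B j) ∧ B j ⊆ E n) → Antitone B →
      (⋂ j, B j) = ∅ → Tendsto (fun j => ∫ ω, (N (B j) ω) ^ 2 ∂P) atTop (𝓝 0)) ∧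
    (∀ A ∈ 𝒜, Tendsto (fun n => ∫ ω, (N A ω - N (A ∩ E n) ω) ^ 2 ∂P) atTop (𝓝 0))

/-- Cylindrical orthogonal martingale-valued measures `M(t, A)(x*)`, `t ≥ 0`, `A ∈ 𝒜`,
`x* ∈ X*`. Each `M(t, A)` is a (representative of a) continuous linear map from `X*` to `L⁰(Ω)`
with convergence in probability. -/
structure IsCylOrthMartMeasure {Ω U X : Type*} [mΩ : MeasurableSpace Ω] [MeasurableSpace U]
    [NormedAddCommGroup X] [NormedSpace ℝ X] (P : Measure Ω) (𝓕 : Filtration ℝ≥0 mΩ)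
    (𝒜 : Set (Set U)) (M : ℝ≥0 → Set U → StrongDual ℝ X → Ω → ℝ) : Prop where
  linear : ∀ t, ∀ A ∈ 𝒜, ∀ (c : ℝ) (x y : StrongDual ℝ X),
    ∀ᵐ ω ∂P, M t A (c • x + y) ω = c * M t A x ω + M t A y ω
  continuous : ∀ t, ∀ A ∈ 𝒜, ∀ (u : ℕ → StrongDual ℝ X) (x : StrongDual ℝ X),
    Tendsto u atTop (𝓝 x) → TendstoInMeasure P (fun n => M t A (u n)) atTop (M t A x)
  zero : ∀ A ∈ 𝒜, ∀ x, ∀ᵐ ω ∂P, M 0 A x ω = 0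
  martingale : ∀ A ∈ 𝒜, ∀ x, IsL2Martingale P 𝓕 fun t => M t A x
  measure : ∀ t, 0 < t → ∀ x, IsSigmaFiniteL2Measure P 𝒜 fun A => M t A x
  /- `⟨M(A)(x*), M(B)(x*)⟩ = 0` -/
  orthogonal : ∀ A ∈ 𝒜, ∀ B ∈ 𝒜, Disjoint A B → ∀ x,
    IsQuadCov P 𝓕 (fun t => M t A x) (fun t => M t B x) fun _ _ => 0

/-- `ν` is (a version of) the intensity measure of the real-valued martingale-valued measure
`N(t, A)`: the a.s. unique predictable `σ`-finite random measure on `ℬ(ℝ₊) ⊗ ℬ(U)` such that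
`ν([0, t] × A) = ⟨N(A)⟩_t` a.s. for all `t ≥ 0`, `A ∈ 𝒜`. -/
structure IsIntensity {Ω U : Type*} [mΩ : MeasurableSpace Ω] [MeasurableSpace U]
    (P : Measure Ω) (𝓕 : Filtration ℝ≥0 mΩ) (𝒜 : Set (Set U)) (N : ℝ≥0 → Set U → Ω → ℝ)
    (ν : Ω → Measure (ℝ≥0 × U)) : Prop where
  measurable : Measurable ν
  sigmaFinite : ∀ᵐ ω ∂P, SigmaFinite (ν ω)
  predictable : ∀ A, MeasurableSet A → IsStronglyPredictable 𝓕 fun t ω => ν ω (Icc 0 t ×ˢ A)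
  bracket : ∀ A ∈ 𝒜, ∃ V, IsQuadCov P 𝓕 (fun t => N t A) (fun t => N t A) V ∧
    ∀ t, ∀ᵐ ω ∂P, ν ω (Icc 0 t ×ˢ A) < ∞ ∧ (ν ω (Icc 0 t ×ˢ A)).toReal = V t ω

/-- The random measure `η` is a quadratic variation, where `ν x*` are the intensity measures:
`η` is a.s. finite on each `[0, t] × A`, and minimal, for the a.s. order, among the random measures
that dominate `ν x*` for every `x*` of norm one. -/
structure IsQuadVar {Ω U X : Type*} [MeasurableSpace Ω] [MeasurableSpace U]
    [NormedAddCommGroup X] [NormedSpace ℝ X] (P : Measure Ω) (𝒜 : Set (Set U))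
    (ν : StrongDual ℝ X → Ω → Measure (ℝ≥0 × U)) (η : Ω → Measure (ℝ≥0 × U)) : Prop where
  measurable : Measurable η
  finite : ∀ t : ℝ≥0, ∀ A ∈ 𝒜, ∀ᵐ ω ∂P, η ω (Icc 0 t ×ˢ A) < ∞
  upper : ∀ x, ‖x‖ = 1 → ∀ᵐ ω ∂P, ν x ω ≤ η ω
  minimal : ∀ ζ : Ω → Measure (ℝ≥0 × U), Measurable ζ →
    (∀ x, ‖x‖ = 1 → ∀ᵐ ω ∂P, ν x ω ≤ ζ ω) → (∀ᵐ ω ∂P, ζ ω ≤ η ω) → ∀ᵐ ω ∂P, η ω ≤ ζ ω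

/-- The sequential boundedness property of a family of intensity measures. -/
def SeqBounded {Ω U X : Type*} [MeasurableSpace Ω] [MeasurableSpace U]
    [NormedAddCommGroup X] [NormedSpace ℝ X] (P : Measure Ω) (𝒜 : Set (Set U))
    (ν : StrongDual ℝ X → Ω → Measure (ℝ≥0 × U)) : Prop :=
  ∀ u : ℕ → StrongDual ℝ X, (∀ n, ‖u n‖ = 1) →
    Metric.sphere (0 : StrongDual ℝ X) 1 ⊆ closure (range u) →
    ∀ x : StrongDual ℝ X, ‖x‖ = 1 → ∀ t : ℝ≥0, 0 < t →
      ∀ᵐ ω ∂P, ∀ s, s < t → ∀ A ∈ 𝒜, ν x ω (Ioc s t ×ˢ A) ≤ ⨆ n, ν (u n) ω (Ioc s t ×ˢ A)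

/-- `α(C)(x*, y*) = (ν_{x* + y*}(C) - ν_{x* - y*}(C)) / 4`, to be used where both terms are
finite. Here `ν` is the family of intensity measures at a fixed `ω`. -/
def alpha {U X : Type*} [MeasurableSpace U] [NormedAddCommGroup X] [NormedSpace ℝ X]
    (ν : StrongDual ℝ X → Measure (ℝ≥0 × U)) (C : Set (ℝ≥0 × U)) (x y : StrongDual ℝ X) : ℝ :=
  ((ν (x + y) C).toReal - (ν (x - y) C).toReal) / 4

/-- Bounded bilinear forms on `X* × X*`, with the operator norm. -/
abbrev Bil (X : Type*) [NormedAddCommGroup X] [NormedSpace ℝ X] : Type _ :=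
  StrongDual ℝ X →L[ℝ] StrongDual ℝ X →L[ℝ] ℝ

/-- A subset of `ℝ₊ × U`, seen as a subset of `[0, T] × U`. -/
def onIcc {U : Type*} (T : ℝ≥0) (C : Set (ℝ≥0 × U)) : Set (Icc (0 : ℝ≥0) T × U) :=
  {p | ((p.1 : ℝ≥0), p.2) ∈ C}

end CylMVM

end

open CylMVM

/-! Each bracket of M(A)(x) is the predictable compensator of the square of M(A)(x), and
compensators are unique. Hence the parallelogram law for squares passes to the intensities: almost
surely ν_{x+y} + ν_{x-y} = 2ν_x + 2ν_y as measures. In the same way ν_{cx} = c²ν_x, so that ν_x ≤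
‖x‖²[M] almost surely.

The exceptional null sets depend on the vectors, which is why versions are needed. Take a countable
dense subgroup G of X*; off one null set both relations hold throughout G (`ae_quadFam`). For such ω
and any measurable C with [M](C) finite, Jordan–von Neumann polarization and Cauchy–Schwarz give a
biadditive form on G bounded by [M](C)‖x‖‖y‖. By continuity it extends uniquely to a bounded
bilinear form `bilOf` on X*, of norm at most [M](C). The new version of ν_x(C) is the value of this
form at (x, x), so α coincides with `bilOf` and part 1 is the norm bound. For disjoint sets the same
bound dominates the norms by a convergent series, which gives countable additivity in norm for part
2. That the new version of ν_x agrees almost surely with the old one, for a given x, follows by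
repeating the construction with the group generated by G and x: by density it yields the same form
(`QuadFam.extension_eq`).

The probabilistic input is `IsCompensator.unique`, i.e. a predictable right-continuous martingale W
of finite variation, null at zero, vanishes. Stop it at the time S when its variation exceeds n, and
write W = p - q with p, q increasing. The stopped martingale property says that dp and dq on (0, S]
integrate bounded predictable processes equally (`integral_predictable_eq`). With f(x) = √(1 + x²),
telescope f(W_S) - f(0) along a grid into slopes of f times increments of W. Replacing the right
endpoint of each slope by the running value W_u makes the integrand predictable, so its dp and dq
integrals cancel; the error tends to zero with the mesh by right-continuity. Hence E f(W_S) = f(0),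
which forces W_S = 0. -/

namespace CylMVM

/-! ### Grid approximation of times and optional sampling. -/

/-- The upper grid approximation `min T ((⌊(m + 1) r⌋ + 1) / (m + 1))` of `r`. -/
noncomputable def gridUp (T : ℝ≥0) (m : ℕ) (r : ℝ≥0) : ℝ≥0 :=
  min T (((⌊((m : ℝ≥0) + 1) * r⌋₊ : ℝ≥0) + 1) / ((m : ℝ≥0) + 1))

lemma lt_grid (m : ℕ) (r : ℝ≥0) :
    r < ((⌊((m : ℝ≥0) + 1) * r⌋₊ : ℝ≥0) + 1) / ((m : ℝ≥0) + 1) := by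
  rw [lt_div_iff₀ (by positivity), mul_comm]
  exact Nat.lt_floor_add_one _

lemma grid_le (m : ℕ) (r : ℝ≥0) :
    ((⌊((m : ℝ≥0) + 1) * r⌋₊ : ℝ≥0) + 1) / ((m : ℝ≥0) + 1) ≤ r + 1 / ((m : ℝ≥0) + 1) := by
  rw [add_div]
  gcongr
  rw [div_le_iff₀ (by positivity), mul_comm r]
  exact Nat.floor_le zero_le

lemma tendsto_one_div_succ : Tendsto (fun m : ℕ => 1 / ((m : ℝ≥0) + 1)) atTop (𝓝 0) := by
  rw [← NNReal.tendsto_coe]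
  simpa using tendsto_one_div_add_atTop_nhds_zero_nat (𝕜 := ℝ)

lemma tendsto_grid (r : ℝ≥0) :
    Tendsto (fun m : ℕ => ((⌊((m : ℝ≥0) + 1) * r⌋₊ : ℝ≥0) + 1) / ((m : ℝ≥0) + 1)) atTop
      (𝓝[≥] r) := by
  refine tendsto_nhdsWithin_iff.2 ⟨?_, .of_forall fun m => (lt_grid m r).le⟩
  refine tendsto_of_tendsto_of_tendsto_of_le_of_le tendsto_const_nhds ?_
    (fun m => (lt_grid m r).le) (grid_le · r)
  simpa using tendsto_const_nhds.add tendsto_one_div_succ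

lemma tendsto_gridUp {T r : ℝ≥0} (h : r ≤ T) :
    Tendsto (fun m : ℕ => gridUp T m r) atTop (𝓝[≥] r) := by
  refine tendsto_nhdsWithin_iff.2 ⟨?_, .of_forall fun m => le_min h (lt_grid m r).le⟩
  have := (tendsto_nhdsWithin_iff.1 (tendsto_grid r)).1
  simpa [gridUp, min_eq_right h] using (tendsto_const_nhds (x := T)).min this

/-- The strict inequality on the right is the point: it makes the grid approximation of τ a stopping
time when only the events {τ < t} are known to lie in 𝓕 t. -/
lemma gridUp_le_iff {T t : ℝ≥0} (ht : t < T) (m : ℕ) (r : ℝ≥0) :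
    gridUp T m r ≤ t ↔ r < (⌊((m : ℝ≥0) + 1) * t⌋₊ : ℝ≥0) / ((m : ℝ≥0) + 1) := by
  rw [gridUp, min_le_iff, or_iff_right (not_le.2 ht), div_le_iff₀ (by positivity),
    lt_div_iff₀ (by positivity), mul_comm t, mul_comm r]
  rw [show ((⌊((m : ℝ≥0) + 1) * r⌋₊ : ℝ≥0) + 1) = ((⌊((m : ℝ≥0) + 1) * r⌋₊ + 1 : ℕ) : ℝ≥0) by
    push_cast; rfl, ← Nat.le_floor_iff zero_le, Nat.succ_le_iff, Nat.floor_lt zero_le]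

variable {Ω : Type*} [mΩ : MeasurableSpace Ω]

lemma measurable_apply_countable {F : ℕ → Ω → ℝ} (hF : ∀ k, Measurable (F k)) {κ : Ω → ℕ}
    (hκ : Measurable κ) : Measurable fun ω => F (κ ω) ω :=
  (measurable_from_prod_countable_right (f := fun p : ℕ × Ω => F p.1 p.2) hF).comp
    (hκ.prodMk measurable_id)

/-- A right-continuous process evaluated at a random time is measurable. -/
lemma measurable_eval {W : ℝ≥0 → Ω → ℝ} (hW : ∀ t, Measurable (W t))
    (hrc : ∀ ω t, ContinuousWithinAt (fun r => W r ω) (Ici t) t) {τ : Ω → ℝ≥0}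
    (hτ : Measurable τ) : Measurable fun ω => W (τ ω) ω := by
  refine measurable_of_tendsto_metrizable (f := fun m ω =>
    W (((⌊((m : ℝ≥0) + 1) * τ ω⌋₊ : ℝ≥0) + 1) / ((m : ℝ≥0) + 1)) ω) (fun m => ?_) ?_
  · exact measurable_apply_countable (fun k : ℕ => hW (((k : ℝ≥0) + 1) / ((m : ℝ≥0) + 1)))
      (Nat.measurable_floor.comp (hτ.const_mul _))
  · rw [tendsto_pi_nhds]
    intro ω
    exact (hrc ω (τ ω)).tendsto.comp (tendsto_grid _)

/-- Optional sampling at a bounded optional time, for right-continuous martingales. -/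
lemma optional_sampling {P : Measure Ω} [IsFiniteMeasure P] {𝓕 : Filtration ℝ≥0 mΩ}
    {W : ℝ≥0 → Ω → ℝ} (hW : Martingale W 𝓕 P)
    (hrc : ∀ ω t, ContinuousWithinAt (fun r => W r ω) (Ici t) t) {τ : Ω → ℝ≥0} {T : ℝ≥0}
    (hτT : ∀ ω, τ ω ≤ T) (hτ : ∀ t, MeasurableSet[𝓕 t] {ω | τ ω < t}) :
    Integrable (fun ω => W (τ ω) ω) P ∧ ∫ ω, W (τ ω) ω ∂P = ∫ ω, W T ω ∂P := by
  have hst : ∀ m, IsStoppingTime 𝓕 fun ω => ((gridUp T m (τ ω) : ℝ≥0) : WithTop ℝ≥0) := by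
    intro m t
    simp only [WithTop.coe_le_coe]
    rcases le_or_gt T t with h | h
    · simp [gridUp, h]
    · simp only [gridUp_le_iff h]
      refine 𝓕.mono ?_ _ (hτ _)
      rw [div_le_iff₀ (by positivity), mul_comm]
      exact Nat.floor_le zero_le
  have hle : ∀ m ω, ((gridUp T m (τ ω) : ℝ≥0) : WithTop ℝ≥0) ≤ T := fun m ω =>
    WithTop.coe_le_coe.2 (min_le_left _ _)
  have hcount : ∀ m, (range fun ω => ((gridUp T m (τ ω) : ℝ≥0) : WithTop ℝ≥0)).Countable := by
    intro m
    refine (countable_range fun k : ℕ =>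
      ((min T (((k : ℝ≥0) + 1) / ((m : ℝ≥0) + 1)) : ℝ≥0) : WithTop ℝ≥0)).mono ?_
    rintro _ ⟨ω, rfl⟩
    exact ⟨⌊((m : ℝ≥0) + 1) * τ ω⌋₊, rfl⟩
  have hce : ∀ m, (fun ω => W (gridUp T m (τ ω)) ω) =ᵐ[P] P[W T | (hst m).measurableSpace] :=
    fun m => hW.stoppedValue_ae_eq_condExp_of_le_const_of_countable_range (hst m) (hle m) (hcount m)
  -- The sampled values are conditional expectations of the single variable W T, hence uniformly
  -- integrable; pointwise convergence from the right then upgrades to convergence in L¹.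
  have hui : UniformIntegrable (fun m => P[W T | (hst m).measurableSpace]) 1 P :=
    (hW.integrable T).uniformIntegrable_condExp fun m => (hst m).measurableSpace_le
  have hui' : UniformIntegrable (fun m ω => W (gridUp T m (τ ω)) ω) 1 P :=
    hui.ae_eq fun m => (hce m).symm
  have hlim : ∀ ω, Tendsto (fun m => W (gridUp T m (τ ω)) ω) atTop (𝓝 (W (τ ω) ω)) := fun ω =>
    (hrc ω (τ ω)).tendsto.comp (tendsto_gridUp (hτT ω))
  have hint : MemLp (fun ω => W (τ ω) ω) 1 P :=
    hui'.memLp_of_ae_tendsto (.of_forall hlim)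
  refine ⟨memLp_one_iff_integrable.1 hint, ?_⟩
  have hL := tendsto_Lp_finite_of_tendsto_ae le_rfl ENNReal.one_ne_top hui'.1 hint hui'.2.1
    (.of_forall hlim)
  have hI := tendsto_integral_of_L1' _ hint.1
    (.of_forall fun m => (integrable_condExp.congr (hce m).symm)) hL
  refine tendsto_nhds_unique hI ?_
  refine tendsto_const_nhds.congr fun m => ?_
  rw [integral_congr_ae (hce m), integral_condExp]

end CylMVM

/-! ### Variation of right-continuous paths and the time it exceeds a level. -/

namespace CylMVM

/-- The variation of a path on `[0, t]`. -/
noncomputable def pathVar (w : ℝ≥0 → ℝ) (t : ℝ≥0) : ℝ := variationOnFromTo w univ 0 t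

section Path

variable {w : ℝ≥0 → ℝ}

lemma pathVar_eq (w : ℝ≥0 → ℝ) (t : ℝ≥0) : pathVar w t = (eVariationOn w (Icc 0 t)).toReal := by
  rw [pathVar, variationOnFromTo.eq_of_le _ _ zero_le, univ_inter]

lemma pathVar_zero (w : ℝ≥0 → ℝ) : pathVar w 0 = 0 := variationOnFromTo.self _ _ _

lemma pathVar_mono (hw : LocallyBoundedVariationOn w univ) : Monotone (pathVar w) :=
  monotoneOn_univ.1 (variationOnFromTo.monotoneOn hw (mem_univ 0))

lemma pathVar_nonneg (w : ℝ≥0 → ℝ) (t : ℝ≥0) : 0 ≤ pathVar w t :=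
  variationOnFromTo.nonneg_of_le _ _ zero_le

lemma abs_sub_le_pathVar (hw : LocallyBoundedVariationOn w univ) {s t : ℝ≥0} (h : s ≤ t) :
    |w t - w s| ≤ pathVar w t - pathVar w s :=
  variationOnFromTo.abs_sub_le_sub_of_le hw (mem_univ _) (mem_univ _) (mem_univ _) h

lemma pathVar_rightCont (hw : LocallyBoundedVariationOn w univ)
    (hrc : ∀ t, ContinuousWithinAt w (Ici t) t) (t : ℝ≥0) :
    ContinuousWithinAt (pathVar w) (Ici t) t := by
  rw [← continuousWithinAt_Ioi_iff_Ici]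
  have h := variationOnFromTo.tendsto_right (mem_univ (0 : ℝ≥0)) (mem_univ t) hw (l := w t)
    (by rw [univ_inter]; exact (hrc t).mono Ioi_subset_Ici_self)
  rw [univ_inter] at h
  simp only [dist_self, add_zero] at h
  exact h

/-- The variation up to S is the variation before S, at most n, plus the jump at S. The left limit
is at most n in absolute value because the path starts at 0, so the jump is at most |w S| + n. -/
lemma pathVar_le_of_lt (hw : LocallyBoundedVariationOn w univ) (h0 : w 0 = 0) {S : ℝ≥0} {n : ℝ}
    (hn : 0 ≤ n) (h : ∀ u < S, pathVar w u ≤ n) : pathVar w S ≤ 2 * n + |w S| := by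
  rcases eq_or_ne S 0 with rfl | hS
  · rw [pathVar_zero]; positivity
  have hne : (𝓝[<] S).NeBot := nhdsLT_neBot_of_exists_lt ⟨0, pos_iff_ne_zero.2 hS⟩
  obtain ⟨l, hl⟩ : ∃ l, Tendsto w (𝓝[<] S) (𝓝 l) := by
    obtain ⟨l, hl⟩ := (hw 0 S (mem_univ _) (mem_univ _)).exists_tendsto_left S
    have : univ ∩ Icc 0 S ∩ Iio S = Iio S := by
      ext u
      simpa using fun h : u < S => h.le
    exact ⟨l, this ▸ hl⟩
  have h1 := variationOnFromTo.tendsto_left (mem_univ (0 : ℝ≥0)) (mem_univ S) hw (l := l)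
    (by rwa [univ_inter])
  rw [univ_inter] at h1
  have hb : ∀ᶠ u in 𝓝[<] S, pathVar w u ≤ n := by
    filter_upwards [self_mem_nhdsWithin] with u hu using h u hu
  have h2 := le_of_tendsto h1 hb
  have h3 : |l| ≤ n := by
    refine le_of_tendsto hl.abs ?_
    filter_upwards [hb] with u hu
    have := abs_sub_le_pathVar hw (zero_le (a := u))
    rw [h0, pathVar_zero, sub_zero, sub_zero] at this
    exact this.trans hu
  have h4 : dist (w S) l ≤ |w S| + n := by
    rw [Real.dist_eq]
    exact (abs_sub _ _).trans (by gcongr)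
  rw [pathVar]
  linarith

/-- The variation on `[0, t]` of a right-continuous path is the supremum of the variations along
grids. -/
lemma eVariationOn_Icc_eq_iSup (hrc : ∀ t, ContinuousWithinAt w (Ici t) t) (t : ℝ≥0) :
    eVariationOn w (Icc 0 t) = ⨆ m : ℕ, ∑ i ∈ Finset.range (⌊((m : ℝ≥0) + 1) * t⌋₊ + 1),
      edist (w (min t ((i : ℝ≥0) / (m + 1)))) (w (min t (((i + 1 : ℕ) : ℝ≥0) / (m + 1)))) := by
  have hmono : ∀ m : ℕ, Monotone fun i : ℕ => min t ((i : ℝ≥0) / (m + 1)) := by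
    intro m i j hij
    dsimp only
    gcongr
  have hgrid : ∀ m : ℕ, _ := fun m => eVariationOn.image_range_of_monotone w (hmono m)
    (⌊((m : ℝ≥0) + 1) * t⌋₊ + 1)
  simp only [← hgrid]
  refine le_antisymm (le_of_forall_lt fun v hv => ?_) (iSup_le fun m => eVariationOn.mono _ ?_)
  -- Variation is lower semicontinuous under pointwise limits. The paths w ∘ gridUp converge to w by
  -- right-continuity and only see grid values.
  · have := eVariationOn.lowerSemicontinuous_aux (F := fun m u => w (gridUp t m u)) (p := atTop)
      (fun u hu => (hrc u).tendsto.comp (tendsto_gridUp hu.2)) hv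
    obtain ⟨m, hm⟩ := this.exists
    refine hm.trans_le (le_trans ?_ (le_iSup _ m))
    refine eVariationOn.comp_le_of_monotoneOn w (gridUp t m) ?_ ?_
    · intro a _ b _ hab
      simp only [gridUp]
      gcongr
    · intro u hu
      refine ⟨⌊((m : ℝ≥0) + 1) * u⌋₊ + 1, ?_, by simp [gridUp]⟩
      simp only [mem_Iic]
      gcongr
      exact hu.2
  · rintro _ ⟨i, -, rfl⟩
    exact ⟨zero_le, min_le_left _ _⟩

end Path

variable {Ω : Type*} [mΩ : MeasurableSpace Ω]

lemma measurable_pathVar {W : ℝ≥0 → Ω → ℝ}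
    (hrc : ∀ ω t, ContinuousWithinAt (fun r => W r ω) (Ici t) t) (t : ℝ≥0)
    (hW : ∀ s ≤ t, Measurable (W s)) :
    Measurable fun ω => pathVar (fun r => W r ω) t := by
  simp only [pathVar_eq, eVariationOn_Icc_eq_iSup (hrc _)]
  refine (Measurable.iSup fun m => Finset.measurable_sum _ fun i _ => ?_).ennreal_toReal
  exact (hW _ (min_le_left _ _)).edist (hW _ (min_le_left _ _))

/-- The first time before `T` at which the variation of the path exceeds `n`. -/
noncomputable def varTime (T : ℝ≥0) (n : ℝ) (w : ℝ≥0 → ℝ) : ℝ≥0 :=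
  sInf ({t | n < pathVar w t} ∪ {T})

lemma varTime_le (T : ℝ≥0) (n : ℝ) (w : ℝ≥0 → ℝ) : varTime T n w ≤ T :=
  csInf_le (OrderBot.bddBelow _) (Or.inr rfl)

lemma pathVar_le_of_lt_varTime {T : ℝ≥0} {n : ℝ} {w : ℝ≥0 → ℝ} {u : ℝ≥0}
    (h : u < varTime T n w) : pathVar w u ≤ n := by
  by_contra! hn
  have hu : u ∈ {t | n < pathVar w t} ∪ {T} := Or.inl hn
  exact (csInf_le (OrderBot.bddBelow _) hu).not_gt h

lemma varTime_eq {T : ℝ≥0} {n : ℝ} {w : ℝ≥0 → ℝ} (hw : LocallyBoundedVariationOn w univ)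
    (h : pathVar w T ≤ n) : varTime T n w = T := by
  refine le_antisymm (varTime_le _ _ _) (le_csInf ⟨T, Or.inr rfl⟩ ?_)
  rintro t (ht | rfl)
  · by_contra! hlt
    exact (ht.trans_le ((pathVar_mono hw hlt.le).trans h)).false
  · rfl

/-- Monotonicity of the variation reduces the infimum to countably many times, which yields
measurability of {varTime < t} at time t. -/
lemma varTime_lt_iff {T t : ℝ≥0} (ht : t ≤ T) {n : ℝ} {w : ℝ≥0 → ℝ}
    (hw : LocallyBoundedVariationOn w univ) :
    varTime T n w < t ↔ ∃ q : ℕ, TopologicalSpace.denseSeq ℝ≥0 q < t ∧ n < pathVar w (TopologicalSpace.denseSeq ℝ≥0 q) := by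
  constructor
  · intro h
    obtain ⟨r, hr | rfl, hrt⟩ := exists_lt_of_csInf_lt ⟨T, Or.inr rfl⟩ h
    · obtain ⟨_, ⟨q, rfl⟩, h1, h2⟩ := (TopologicalSpace.denseRange_denseSeq ℝ≥0).exists_between hrt
      exact ⟨q, h2, lt_of_lt_of_le hr (pathVar_mono hw h1.le)⟩
    · exact absurd hrt (not_lt.2 ht)
  · rintro ⟨q, hq, hn⟩
    have hu : TopologicalSpace.denseSeq ℝ≥0 q ∈ {t | n < pathVar w t} ∪ {T} := Or.inl hn
    exact (csInf_le (OrderBot.bddBelow _) hu).trans_lt hq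

lemma measurableSet_varTime_lt {𝓕 : Filtration ℝ≥0 mΩ} {W : ℝ≥0 → Ω → ℝ}
    (hrc : ∀ ω t, ContinuousWithinAt (fun r => W r ω) (Ici t) t)
    (hbv : ∀ ω, LocallyBoundedVariationOn (fun r => W r ω) univ)
    (hW : ∀ t, Measurable[𝓕 t] (W t)) (T : ℝ≥0) (n : ℝ) (t : ℝ≥0) :
    MeasurableSet[𝓕 t] {ω | varTime T n (fun r => W r ω) < t} := by
  rcases lt_or_ge T t with h | h
  · convert MeasurableSet.univ (α := Ω) (m := 𝓕 t)
    ext ω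
    simpa using (varTime_le _ _ _).trans_lt h
  · simp only [varTime_lt_iff h (hbv _), ofPred_exists]
    refine MeasurableSet.iUnion fun q => ?_
    by_cases hq : TopologicalSpace.denseSeq ℝ≥0 q < t
    · simp only [hq, true_and]
      refine 𝓕.mono hq.le _ ?_
      exact (measurable_pathVar (mΩ := 𝓕 _) hrc _ fun s hs =>
        (hW s).mono (𝓕.mono hs) le_rfl) measurableSet_Ioi
    · simp [hq]

end CylMVM

/-! ### Slopes of √(1 + x²), Stieltjes kernels and the predictable σ-algebra. -/

namespace CylMVM

/-- The slope of `x ↦ √(1 + x²)` between `a` and `b`. -/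
noncomputable def sqrtSlope (a b : ℝ) : ℝ := (a + b) / (√(1 + a ^ 2) + √(1 + b ^ 2))

lemma one_le_sqrt_one_add_sq (a : ℝ) : 1 ≤ √(1 + a ^ 2) := by
  rw [Real.one_le_sqrt]; nlinarith [sq_nonneg a]

lemma abs_le_sqrt_one_add_sq (a : ℝ) : |a| ≤ √(1 + a ^ 2) :=
  Real.abs_le_sqrt (by linarith)

lemma abs_sqrtSlope_le (a b : ℝ) : |sqrtSlope a b| ≤ 1 := by
  have ha := one_le_sqrt_one_add_sq a
  have hb := one_le_sqrt_one_add_sq b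
  rw [sqrtSlope, abs_div, abs_of_pos (show 0 < √(1 + a ^ 2) + √(1 + b ^ 2) by linarith)]
  rw [div_le_one (by linarith)]
  exact (abs_add_le _ _).trans (add_le_add (abs_le_sqrt_one_add_sq a) (abs_le_sqrt_one_add_sq b))

lemma sqrtSlope_mul_sub (a b : ℝ) : sqrtSlope a b * (b - a) = √(1 + b ^ 2) - √(1 + a ^ 2) := by
  have ha := one_le_sqrt_one_add_sq a
  have hb := one_le_sqrt_one_add_sq b
  have ha' := Real.sq_sqrt (show 0 ≤ 1 + a ^ 2 by positivity)
  have hb' := Real.sq_sqrt (show 0 ≤ 1 + b ^ 2 by positivity)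
  rw [sqrtSlope, div_mul_eq_mul_div, div_eq_iff (by linarith)]
  nlinarith

/-- The difference of the slopes is a fraction whose numerator is at most 2|b - c|, since x ↦ √(1 +
x²) is 1-Lipschitz and slopes are at most 1, and whose denominator is at least 2. -/
lemma abs_sqrtSlope_sub_le (a b c : ℝ) : |sqrtSlope a b - sqrtSlope a c| ≤ |b - c| := by
  have ha := one_le_sqrt_one_add_sq a
  have hb := one_le_sqrt_one_add_sq b
  have hc := one_le_sqrt_one_add_sq c
  have hbc : |√(1 + c ^ 2) - √(1 + b ^ 2)| ≤ |b - c| := by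
    rw [← sqrtSlope_mul_sub, abs_mul, abs_sub_comm c b]
    exact mul_le_of_le_one_left (abs_nonneg _) (abs_sqrtSlope_le _ _)
  have key : sqrtSlope a b - sqrtSlope a c = ((b - c) +
      sqrtSlope a c * (√(1 + c ^ 2) - √(1 + b ^ 2))) / (√(1 + a ^ 2) + √(1 + b ^ 2)) := by
    have h1 : √(1 + a ^ 2) + √(1 + b ^ 2) ≠ 0 := by linarith
    have h2 : √(1 + a ^ 2) + √(1 + c ^ 2) ≠ 0 := by linarith
    simp only [sqrtSlope]
    field_simp
    ring
  rw [key, abs_div, abs_of_pos (show 0 < √(1 + a ^ 2) + √(1 + b ^ 2) by linarith),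
    div_le_iff₀ (by linarith)]
  have h3 : |sqrtSlope a c * (√(1 + c ^ 2) - √(1 + b ^ 2))| ≤ |b - c| := by
    rw [abs_mul]
    exact (mul_le_of_le_one_left (abs_nonneg _) (abs_sqrtSlope_le _ _)).trans hbc
  have h4 := abs_add_le (b - c) (sqrtSlope a c * (√(1 + c ^ 2) - √(1 + b ^ 2)))
  nlinarith [abs_nonneg (b - c)]

lemma continuous_sqrtSlope : Continuous fun p : ℝ × ℝ => sqrtSlope p.1 p.2 := by
  refine Continuous.div (by fun_prop) (by fun_prop) fun p => ?_
  have ha := one_le_sqrt_one_add_sq p.1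
  have hb := one_le_sqrt_one_add_sq p.2
  linarith

variable {Ω : Type*} [mΩ : MeasurableSpace Ω]

/-- The Stieltjes measures of a measurable family of increasing right-continuous paths, stopped
and normalized, form a kernel. -/
lemma exists_stieltjes_kernel {p : ℝ≥0 → Ω → ℝ} (hp : ∀ t, Measurable (p t))
    (hmono : ∀ ω, Monotone fun t => p t ω)
    (hrc : ∀ ω t, ContinuousWithinAt (fun r => p r ω) (Ici t) t)
    {S : Ω → ℝ≥0} (hS : Measurable S) {c : Ω → ℝ≥0} (hc : Measurable c) (hc0 : ∀ ω, 0 < c ω)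
    (hpc : ∀ ω, p (S ω) ω - p 0 ω ≤ c ω) :
    ∃ κ : ProbabilityTheory.Kernel Ω ℝ≥0, ProbabilityTheory.IsFiniteKernel κ ∧
      (∀ ω a b, a ≤ b → (c ω : ℝ≥0∞) * κ ω (Ioc a b) =
        ENNReal.ofReal (p (min b (S ω)) ω - p (min a (S ω)) ω)) ∧
      ∀ ω, κ ω (Ioc 0 (S ω))ᶜ = 0 := by
  let st : Ω → StieltjesFunction ℝ≥0 := fun ω => ⟨fun t => p t ω, hmono ω, hrc ω⟩
  -- Dividing by c bounds the total mass by 1, so the kernel is uniformly finite; the factor c is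
  -- later carried by the measure on Ω.
  let k : Ω → Measure ℝ≥0 := fun ω =>
    ((c ω : ℝ≥0∞)⁻¹) • (st ω).measure.restrict (Ioc 0 (S ω))
  have hcne : ∀ ω, (c ω : ℝ≥0∞) ≠ 0 := fun ω => by simpa using (hc0 ω).ne'
  have hIoc : ∀ ω a b, a ≤ b → k ω (Ioc a b) = (c ω : ℝ≥0∞)⁻¹ *
      ENNReal.ofReal (p (min b (S ω)) ω - p (min a (S ω)) ω) := by
    intro ω a b hab
    rw [Measure.smul_apply, Measure.restrict_apply measurableSet_Ioc, Ioc_inter_Ioc, smul_eq_mul,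
      StieltjesFunction.measure_Ioc, sup_eq_left.2 (zero_le (a := a))]
    rcases le_total a (S ω) with h | h
    · simp [st, h]
    · rw [min_eq_right h, min_eq_right (h.trans hab), sub_self, ENNReal.ofReal_zero]
      rw [ENNReal.ofReal_of_nonpos (sub_nonpos.2 ((st ω).mono h))]
  have hnull : ∀ ω, k ω (Ioc 0 (S ω))ᶜ = 0 := by
    intro ω
    rw [Measure.smul_apply, Measure.restrict_apply measurableSet_Ioc.compl]
    simp
  have hIoi : ∀ ω a, k ω (Ioi a) = k ω (Ioc a (max a (S ω))) := by
    intro ω a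
    refine measure_congr (ae_eq_set.2 ⟨measure_mono_null ?_ (hnull ω), ?_⟩)
    · intro u hu hu'
      exact hu.2 ⟨hu.1, le_max_of_le_right hu'.2⟩
    · rw [sdiff_eq_empty.2 Ioc_subset_Ioi_self, measure_empty]
  have huniv : ∀ ω, k ω univ = k ω (Ioi 0) := by
    intro ω
    refine measure_congr (ae_eq_set.2 ⟨measure_mono_null ?_ (hnull ω), by simp⟩)
    intro u hu hu'
    exact hu.2 hu'.1
  have hle : ∀ ω, k ω univ ≤ 1 := by
    intro ω
    rw [huniv, hIoi, hIoc _ _ _ (le_max_left _ _), ENNReal.inv_mul_le_iff (hcne ω) (by simp),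
      mul_one]
    refine ENNReal.ofReal_le_of_le_toReal ?_
    simpa using hpc ω
  have hfin : ∀ ω, IsFiniteMeasure (k ω) := fun ω => ⟨(hle ω).trans_lt (by simp)⟩
  have hmeas : ∀ a, Measurable fun ω => k ω (Ioi a) := by
    intro a
    simp only [hIoi, hIoc _ _ _ (le_max_left _ _)]
    have h1 : Measurable fun ω => p (min (max a (S ω)) (S ω)) ω :=
      measurable_eval hp hrc ((measurable_const.max hS).min hS)
    have h2 : Measurable fun ω => p (min a (S ω)) ω :=
      measurable_eval hp hrc (measurable_const.min hS)
    exact hc.coe_nnreal_ennreal.inv.mul (h1.sub h2).ennreal_ofReal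
  have hk : Measurable k := by
    refine Measurable.measure_of_isPiSystem (S := range Ioi) ?_ ?_ ?_ ?_
    · rw [← borel_eq_generateFrom_Ioi]
      exact BorelSpace.measurable_eq
    · exact isPiSystem_Ioi
    · rintro _ ⟨a, rfl⟩
      exact hmeas a
    · simpa only [huniv] using hmeas 0
  refine ⟨⟨k, hk⟩, ⟨1, by simp, hle⟩, fun ω a b hab => ?_, hnull⟩
  change (c ω : ℝ≥0∞) * k ω (Ioc a b) = _
  rw [hIoc _ _ _ hab, ← mul_assoc, ENNReal.mul_inv_cancel (hcne ω) (by simp), one_mul]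

lemma predictable_le_prod (𝓕 : Filtration ℝ≥0 mΩ) :
    𝓕.predictable ≤ (inferInstance : MeasurableSpace (ℝ≥0 × Ω)) :=
  measurableSpace_le_predictable_of_measurableSet
    (fun _ hA => (measurableSet_singleton _).prod (𝓕.le _ _ hA))
    (fun _ _ hA => measurableSet_Ioi.prod (𝓕.le _ _ hA))

/-- An adapted random variable placed on `(a, b]` is a predictable process. -/
lemma measurable_predictable_indicator {𝓕 : Filtration ℝ≥0 mΩ} {a b : ℝ≥0} {Y : Ω → ℝ}
    (hY : Measurable[𝓕 a] Y) :
    Measurable[𝓕.predictable] ((Ioc a b ×ˢ (univ : Set Ω)).indicator fun p => Y p.2) := by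
  have hI : MeasurableSet[𝓕.predictable] (Ioc a b ×ˢ (univ : Set Ω)) :=
    measurableSet_predictable_Ioc_prod _ _ MeasurableSet.univ
  intro B hB
  rw [indicator_preimage, Set.ite]
  refine MeasurableSet.union ?_ (MeasurableSet.diff ?_ hI)
  · convert measurableSet_predictable_Ioc_prod a b (hY hB) using 1
    ext ⟨t, ω⟩
    simp [and_comm]
  · exact (@measurable_const _ _ _ 𝓕.predictable (0 : ℝ)) hB

lemma isPiSystem_predictable (𝓕 : Filtration ℝ≥0 mΩ) :
    IsPiSystem ({s | ∃ A, MeasurableSet[𝓕 ⊥] A ∧ s = ({⊥} : Set ℝ≥0) ×ˢ A} ∪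
      {s | ∃ i A, MeasurableSet[𝓕 i] A ∧ s = Set.Ioi i ×ˢ A}) := by
  rintro _ (⟨A, hA, rfl⟩ | ⟨i, A, hA, rfl⟩) _ (⟨B, hB, rfl⟩ | ⟨j, B, hB, rfl⟩) hne
  · left
    exact ⟨A ∩ B, hA.inter hB, by rw [prod_inter_prod, inter_self]⟩
  · obtain ⟨⟨u, ω⟩, ⟨hu, -⟩, hu', -⟩ := hne
    simp only [mem_singleton_iff] at hu
    subst hu
    simp at hu'
  · obtain ⟨⟨u, ω⟩, ⟨hu', -⟩, hu, -⟩ := hne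
    simp only [mem_singleton_iff] at hu
    subst hu
    simp at hu'
  · right
    exact ⟨i ⊔ j, A ∩ B, (𝓕.mono le_sup_left _ hA).inter (𝓕.mono le_sup_right _ hB),
      by rw [prod_inter_prod, Ioi_inter_Ioi]⟩

end CylMVM

/-! ### Integration of predictable processes and the two slope processes. -/

namespace CylMVM

variable {Ω : Type*}

open ProbabilityTheory in
/-- Two finite random measures on the time axis whose difference has martingale increments
integrate bounded predictable processes equally. -/
lemma integral_predictable_eq [mΩ : MeasurableSpace Ω] {𝓕 : Filtration ℝ≥0 mΩ}
    {Q : Measure Ω} [IsFiniteMeasure Q]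
    {κ₁ κ₂ : Kernel Ω ℝ≥0} [IsFiniteKernel κ₁] [IsFiniteKernel κ₂]
    (h0 : ∀ ω, κ₁ ω {0} = 0 ∧ κ₂ ω {0} = 0)
    (h : ∀ s F, MeasurableSet[𝓕 s] F →
      ∫⁻ ω in F, κ₁ ω (Ioi s) ∂Q = ∫⁻ ω in F, κ₂ ω (Ioi s) ∂Q)
    {H : ℝ≥0 × Ω → ℝ} (hH : Measurable[𝓕.predictable] H) :
    ∫ p, H p.swap ∂(Q ⊗ₘ κ₁) = ∫ p, H p.swap ∂(Q ⊗ₘ κ₂) := by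
  have hle := predictable_le_prod 𝓕
  have hrect : ∀ (κ : Kernel Ω ℝ≥0) [IsFiniteKernel κ] (I : Set ℝ≥0) (F : Set Ω),
      MeasurableSet I → MeasurableSet F →
      (Q ⊗ₘ κ).map Prod.swap (I ×ˢ F) = ∫⁻ ω in F, κ ω I ∂Q := by
    intro κ _ I F hI hF
    rw [Measure.map_apply measurable_swap (hI.prod hF), preimage_swap_prod,
      Measure.compProd_apply_prod hF hI]
  have hgen : ∀ s ∈ ({s | ∃ A, MeasurableSet[𝓕 ⊥] A ∧ s = ({⊥} : Set ℝ≥0) ×ˢ A} ∪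
      {s | ∃ i A, MeasurableSet[𝓕 i] A ∧ s = Set.Ioi i ×ˢ A}),
      (Q ⊗ₘ κ₁).map Prod.swap s = (Q ⊗ₘ κ₂).map Prod.swap s := by
    rintro _ (⟨A, hA, rfl⟩ | ⟨i, A, hA, rfl⟩)
    · rw [hrect _ _ _ (measurableSet_singleton _) (𝓕.le _ _ hA),
        hrect _ _ _ (measurableSet_singleton _) (𝓕.le _ _ hA)]
      simp [h0]
    · rw [hrect _ _ _ measurableSet_Ioi (𝓕.le _ _ hA), hrect _ _ _ measurableSet_Ioi (𝓕.le _ _ hA),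
        h i A hA]
  have huniv : (univ : Set (ℝ≥0 × Ω)) = {⊥} ×ˢ univ ∪ Ioi 0 ×ˢ univ := by
    ext ⟨t, ω⟩
    simpa using eq_or_ne t 0 |>.imp id pos_iff_ne_zero.2
  have hfin : ∀ (κ : Kernel Ω ℝ≥0) [IsFiniteKernel κ],
      IsFiniteMeasure ((Q ⊗ₘ κ).map Prod.swap) := fun κ _ =>
    Measure.isFiniteMeasure_map _ _
  have := hfin κ₁
  have := hfin κ₂
  -- Only the restrictions to the predictable σ-algebra agree. They agree on a generating π-system,
  -- and the total masses agree because the whole space is a disjoint union of two generators.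
  have htrim : ((Q ⊗ₘ κ₁).map Prod.swap).trim hle = ((Q ⊗ₘ κ₂).map Prod.swap).trim hle := by
    have hall : ∀ s, MeasurableSet[𝓕.predictable] s →
        (Q ⊗ₘ κ₁).map Prod.swap s = (Q ⊗ₘ κ₂).map Prod.swap s := fun s hs =>
      ext_on_measurableSpace_of_generate_finite _ _ hgen hle rfl (isPiSystem_predictable 𝓕) (by
        have hd : Disjoint (({⊥} : Set ℝ≥0) ×ˢ (univ : Set Ω)) (Ioi 0 ×ˢ univ) := by
          rw [Set.disjoint_prod]
          left
          simp
        have hm : MeasurableSet (Ioi (0 : ℝ≥0) ×ˢ (univ : Set Ω)) :=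
          measurableSet_Ioi.prod MeasurableSet.univ
        rw [huniv, measure_union hd hm, measure_union hd hm,
          hgen _ (Or.inl ⟨univ, MeasurableSet.univ, rfl⟩),
          hgen _ (Or.inr ⟨0, univ, MeasurableSet.univ, rfl⟩)]) hs
    refine @Measure.ext _ 𝓕.predictable _ _ fun s hs => ?_
    rw [trim_measurableSet_eq hle hs, trim_measurableSet_eq hle hs, hall s hs]
  have hmap : ∀ (κ : Kernel Ω ℝ≥0) [IsFiniteKernel κ], ∫ p, H p.swap ∂(Q ⊗ₘ κ) =
      ∫ p, H p ∂((Q ⊗ₘ κ).map Prod.swap) := fun κ _ =>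
    (integral_map measurable_swap.aemeasurable
      (hH.mono hle le_rfl).aestronglyMeasurable).symm
  rw [hmap, hmap, integral_trim hle hH.stronglyMeasurable, htrim,
    ← integral_trim hle hH.stronglyMeasurable]

/-- Disjoint consecutive intervals. -/
lemma sum_indicator_Ioc_le {t : ℕ → ℝ≥0} (ht : Monotone t) (m : ℕ) (u : ℝ≥0) :
    ∑ i ∈ Finset.range m, (Ioc (t i) (t (i + 1))).indicator (fun _ => (1 : ℝ)) u ≤ 1 := by
  have : ∑ i ∈ Finset.range m, (Ioc (t i) (t (i + 1))).indicator (fun _ => (1 : ℝ)) u =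
      (Ioc (t 0) (t m)).indicator (fun _ => (1 : ℝ)) u := by
    induction m with
    | zero => simp
    | succ m ih =>
      rw [Finset.sum_range_succ, ih, ← Ioc_union_Ioc_eq_Ioc (ht (Nat.zero_le m)) (ht m.le_succ),
        indicator_union_of_disjoint (Ioc_disjoint_Ioc_of_le le_rfl)]
  rw [this]
  exact indicator_le_self' (by simp) u

section Riemann

variable {W : ℝ≥0 → Ω → ℝ} {S : Ω → ℝ≥0}

/-- The step process with value `sqrtSlope (W (t i)) (W (min (t (i + 1)) S))` on
`(t i, t (i + 1)]`. -/
noncomputable def stepSlope (W : ℝ≥0 → Ω → ℝ) (S : Ω → ℝ≥0) (t : ℕ → ℝ≥0) (m : ℕ)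
    (p : ℝ≥0 × Ω) : ℝ :=
  ∑ i ∈ Finset.range m, (Ioc (t i) (t (i + 1))).indicator
    (fun _ => sqrtSlope (W (min (t i) (S p.2)) p.2) (W (min (t (i + 1)) (S p.2)) p.2)) p.1

/-- The process with value `sqrtSlope (W (t i)) (W u)` at `u ∈ (t i, t (i + 1)]`. -/
noncomputable def predSlope (W : ℝ≥0 → Ω → ℝ) (t : ℕ → ℝ≥0) (m : ℕ) (p : ℝ≥0 × Ω) : ℝ :=
  ∑ i ∈ Finset.range m, (Ioc (t i) (t (i + 1))).indicator
    (fun u => sqrtSlope (W (t i) p.2) (W u p.2)) p.1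

lemma abs_stepSlope_le {t : ℕ → ℝ≥0} (ht : Monotone t) (m : ℕ) (p : ℝ≥0 × Ω) :
    |stepSlope W S t m p| ≤ 1 := by
  refine (Finset.abs_sum_le_sum_abs _ _).trans
    ((Finset.sum_le_sum fun i _ => ?_).trans (sum_indicator_Ioc_le ht m p.1))
  by_cases h : p.1 ∈ Ioc (t i) (t (i + 1))
  · simpa [h] using abs_sqrtSlope_le _ _
  · simp [h]

lemma abs_predSlope_le {t : ℕ → ℝ≥0} (ht : Monotone t) (m : ℕ) (p : ℝ≥0 × Ω) :
    |predSlope W t m p| ≤ 1 := by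
  refine (Finset.abs_sum_le_sum_abs _ _).trans
    ((Finset.sum_le_sum fun i _ => ?_).trans (sum_indicator_Ioc_le ht m p.1))
  by_cases h : p.1 ∈ Ioc (t i) (t (i + 1))
  · simpa [h] using abs_sqrtSlope_le _ _
  · simp [h]

lemma measurable_predSlope [mΩ : MeasurableSpace Ω] {𝓕 : Filtration ℝ≥0 mΩ}
    (hW : IsStronglyPredictable 𝓕 W)
    (t : ℕ → ℝ≥0) (m : ℕ) : Measurable[𝓕.predictable] (predSlope W t m) := by
  refine Finset.measurable_sum _ fun i _ => ?_
  have h1 := measurable_predictable_indicator (a := t i) (b := t (i + 1))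
    (hW.stronglyAdapted (t i)).measurable
  have h2 : Measurable[𝓕.predictable] (fun p : ℝ≥0 × Ω => W p.1 p.2) :=
    StronglyMeasurable.measurable hW
  have hI : MeasurableSet[𝓕.predictable] (Ioc (t i) (t (i + 1)) ×ˢ (univ : Set Ω)) :=
    measurableSet_predictable_Ioc_prod _ _ MeasurableSet.univ
  have h3 := (continuous_sqrtSlope.measurable.comp (h1.prodMk h2)).indicator hI
  convert h3 using 1
  ext ⟨u, ω⟩
  by_cases h : u ∈ Ioc (t i) (t (i + 1))
  · simp only [mem_Ioc] at h
    simp [indicator, h]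
  · simp only [mem_Ioc] at h
    simp [indicator, h]

lemma measurable_stepSlope [mΩ : MeasurableSpace Ω]
    (hW : ∀ t, Measurable (W t))
    (hrc : ∀ ω t, ContinuousWithinAt (fun r => W r ω) (Ici t) t) (hS : Measurable S)
    (t : ℕ → ℝ≥0) (m : ℕ) : Measurable (stepSlope W S t m) := by
  refine Finset.measurable_sum _ fun i _ => ?_
  have h : ∀ a, Measurable fun ω => W (min a (S ω)) ω := fun a =>
    measurable_eval hW hrc (measurable_const.min hS)
  have h1 : Measurable fun ω => sqrtSlope (W (min (t i) (S ω)) ω) (W (min (t (i + 1)) (S ω)) ω) :=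
    continuous_sqrtSlope.measurable.comp ((h _).prodMk (h _))
  exact (h1.comp measurable_snd).indicator (measurable_fst measurableSet_Ioc)

/-- At u in (t i, t (i + 1)] the two slopes share the first argument, and their second arguments are
values of W at u and at a time in [u, u + δ]. The slope is 1-Lipschitz there, and at most one index
i contributes. -/
lemma abs_stepSlope_sub_predSlope_le {t : ℕ → ℝ≥0} (ht : Monotone t) (m : ℕ) {u : ℝ≥0} {ω : Ω}
    (hu : u ≤ S ω) {δ : ℝ≥0} (hδ : ∀ i, t (i + 1) ≤ t i + δ) {ε : ℝ}
    (hε : ∀ r, u ≤ r → r ≤ u + δ → |W r ω - W u ω| ≤ ε) :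
    |stepSlope W S t m (u, ω) - predSlope W t m (u, ω)| ≤ ε := by
  have hε0 : 0 ≤ ε := (abs_nonneg _).trans (hε u le_rfl le_self_add)
  rw [stepSlope, predSlope, ← Finset.sum_sub_distrib]
  refine (Finset.abs_sum_le_sum_abs _ _).trans ?_
  calc _ ≤ ∑ i ∈ Finset.range m, ε * (Ioc (t i) (t (i + 1))).indicator (fun _ => (1 : ℝ)) u := by
        refine Finset.sum_le_sum fun i _ => ?_
        by_cases h : u ∈ Ioc (t i) (t (i + 1))
        · simp only [indicator_of_mem h, mul_one, min_eq_left (h.1.le.trans hu)]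
          refine (abs_sqrtSlope_sub_le _ _ _).trans (hε _ (le_min h.2 hu) ?_)
          refine (min_le_left _ _).trans ((hδ i).trans ?_)
          gcongr
          exact h.1.le
        · simp [h]
    _ ≤ ε * 1 := by
        rw [← Finset.mul_sum]
        exact mul_le_mul_of_nonneg_left (sum_indicator_Ioc_le ht m u) hε0
    _ = ε := mul_one _

end Riemann

end CylMVM

/-! ### Limits of the integrals of the slope processes. -/

namespace CylMVM

variable {Ω : Type*} [mΩ : MeasurableSpace Ω]

open ProbabilityTheory

lemma integrable_compProd_of_bound {Q : Measure Ω} [IsFiniteMeasure Q]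
    {κ : Kernel Ω ℝ≥0} [IsFiniteKernel κ] {H : ℝ≥0 × Ω → ℝ} (hH : Measurable H) {C : ℝ}
    (hC : ∀ p, |H p| ≤ C) : Integrable (fun p => H p.swap) (Q ⊗ₘ κ) :=
  Integrable.of_bound (hH.comp measurable_swap).aestronglyMeasurable C
    (.of_forall fun _ => hC _)

/-- For fixed ω the integrand is a step function of time, so its integral is a finite sum of slopes
times increments of p; the density c cancels the normalization of the kernel. -/
lemma integral_stepSlope {P : Measure Ω} {W : ℝ≥0 → Ω → ℝ} {S : Ω → ℝ≥0}
    (hW : ∀ t, Measurable (W t))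
    (hrc : ∀ ω t, ContinuousWithinAt (fun r => W r ω) (Ici t) t) (hS : Measurable S)
    {c : Ω → ℝ≥0} (hc : Measurable c) [IsFiniteMeasure (P.withDensity fun ω => (c ω : ℝ≥0∞))]
    {p : ℝ≥0 → Ω → ℝ} (hp : ∀ ω, Monotone fun t => p t ω)
    {κ : Kernel Ω ℝ≥0} [IsFiniteKernel κ]
    (hκ : ∀ ω a b, a ≤ b → (c ω : ℝ≥0∞) * κ ω (Ioc a b) =
      ENNReal.ofReal (p (min b (S ω)) ω - p (min a (S ω)) ω))
    {t : ℕ → ℝ≥0} (ht : Monotone t) (m : ℕ) :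
    let J := fun ω => ∑ i ∈ Finset.range m,
        sqrtSlope (W (min (t i) (S ω)) ω) (W (min (t (i + 1)) (S ω)) ω) *
          (p (min (t (i + 1)) (S ω)) ω - p (min (t i) (S ω)) ω)
    Integrable J P ∧ ∫ x, stepSlope W S t m x.swap ∂((P.withDensity fun ω => (c ω : ℝ≥0∞)) ⊗ₘ κ) =
      ∫ ω, J ω ∂P := by
  intro J
  have hint := integrable_compProd_of_bound (Q := P.withDensity fun ω => (c ω : ℝ≥0∞)) (κ := κ)
    (measurable_stepSlope hW hrc hS t m) (abs_stepSlope_le ht m)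
  have hJ : ∀ ω, c ω • ∫ u, stepSlope W S t m (u, ω) ∂(κ ω) = J ω := by
    intro ω
    simp only [stepSlope]
    rw [integral_finsetSum _ fun i _ => (integrable_const _).indicator measurableSet_Ioc,
      NNReal.smul_def, smul_eq_mul, Finset.mul_sum]
    refine Finset.sum_congr rfl fun i _ => ?_
    rw [integral_indicator_const _ measurableSet_Ioc, smul_eq_mul, ← mul_assoc, mul_comm]
    congr 1
    have h1 := congrArg ENNReal.toReal (hκ ω (t i) (t (i + 1)) (ht i.le_succ))
    rw [ENNReal.toReal_mul, ENNReal.toReal_ofReal (sub_nonneg.2 (hp ω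
      (min_le_min_right _ (ht i.le_succ))))] at h1
    simpa [Measure.real] using h1
  have hint2 := Integrable.integral_compProd (a := ()) hint
  simp only [Kernel.const_apply, Kernel.prodMkLeft_apply, Prod.swap_prod_mk] at hint2
  constructor
  · rw [integrable_withDensity_iff_integrable_smul hc] at hint2
    exact hint2.congr (.of_forall fun ω => hJ ω)
  · rw [Measure.integral_compProd hint, integral_withDensity_eq_integral_smul hc]
    exact integral_congr_ae (.of_forall fun ω => hJ ω)

/-- Dominated convergence with the bound 2. Right-continuity suffices because κ lives on (0, S],
where the right grid endpoint stopped at S is never before the current time. -/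
lemma tendsto_integral_stepSlope_sub {W : ℝ≥0 → Ω → ℝ} {S : Ω → ℝ≥0}
    {𝓕 : Filtration ℝ≥0 mΩ} (hW : IsStronglyPredictable 𝓕 W)
    (hrc : ∀ ω t, ContinuousWithinAt (fun r => W r ω) (Ici t) t) (hS : Measurable S)
    {Q : Measure Ω} [IsFiniteMeasure Q] {κ : Kernel Ω ℝ≥0} [IsFiniteKernel κ]
    (hκ : ∀ ω, κ ω (Ioc 0 (S ω))ᶜ = 0) {t : ℕ → ℕ → ℝ≥0} (ht : ∀ m, Monotone (t m))
    {δ : ℕ → ℝ≥0} (hδ : Tendsto δ atTop (𝓝 0)) (htδ : ∀ m i, t m (i + 1) ≤ t m i + δ m)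
    (N : ℕ → ℕ) :
    Tendsto (fun m => ∫ x, (stepSlope W S (t m) (N m) x.swap - predSlope W (t m) (N m) x.swap)
      ∂(Q ⊗ₘ κ)) atTop (𝓝 0) := by
  have hWm : ∀ t, Measurable (W t) := fun t =>
    (hW.stronglyAdapted t).measurable.mono (𝓕.le t) le_rfl
  have hae : ∀ᵐ x ∂(Q ⊗ₘ κ), x.2 ≤ S x.1 := by
    refine Measure.ae_compProd_of_ae_ae (measurableSet_le measurable_snd (hS.comp measurable_fst))
      (.of_forall fun ω => ?_)
    refine measure_mono_null ?_ (hκ ω)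
    intro u hu hu'
    exact hu hu'.2
  have := tendsto_integral_of_dominated_convergence (μ := Q ⊗ₘ κ) (f := fun _ => (0 : ℝ))
    (F := fun m x => stepSlope W S (t m) (N m) x.swap - predSlope W (t m) (N m) x.swap)
    (fun _ => 2) (fun m => ?_) (integrable_const _) (fun m => .of_forall fun x => ?_) ?_
  · simpa using this
  · exact (((measurable_stepSlope hWm hrc hS _ _).comp measurable_swap).sub
      (((measurable_predSlope hW _ _).mono (predictable_le_prod 𝓕) le_rfl).comp
        measurable_swap)).aestronglyMeasurable
  · refine (norm_sub_le _ _).trans ?_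
    rw [Real.norm_eq_abs, Real.norm_eq_abs]
    linarith [abs_stepSlope_le (W := W) (S := S) (ht m) (N m) x.swap,
      abs_predSlope_le (W := W) (ht m) (N m) x.swap]
  · filter_upwards [hae] with x hx
    rw [Metric.tendsto_atTop']
    intro ε hε
    obtain ⟨η, hη, hη'⟩ := Metric.continuousWithinAt_iff.1 (hrc x.1 x.2) (ε / 2) (half_pos hε)
    obtain ⟨M, hM⟩ := Metric.tendsto_atTop.1 hδ η hη
    refine ⟨M, fun m hm => ?_⟩
    rw [Real.dist_eq, sub_zero]
    refine lt_of_le_of_lt (abs_stepSlope_sub_predSlope_le (u := x.2) (ω := x.1) (ht m) _ hx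
      (htδ m) (ε := ε / 2) fun r hr1 hr2 => ?_) (half_lt_self hε)
    rw [← Real.dist_eq]
    refine (hη' hr1 ?_).le
    have h1 : dist r x.2 ≤ δ m := by
      rw [NNReal.dist_eq, abs_of_nonneg (by simpa using hr1)]
      have : (r : ℝ) ≤ x.2 + δ m := by exact_mod_cast hr2
      linarith
    have h2 := hM m hm.le
    rw [NNReal.dist_eq, NNReal.coe_zero, sub_zero, abs_of_nonneg (by positivity)] at h2
    exact h1.trans_lt h2

end CylMVM

/-! ### Predictable martingales of finite variation vanish. -/

namespace CylMVM

variable {Ω : Type*} [mΩ : MeasurableSpace Ω]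

open ProbabilityTheory

/-- Increments of a right-continuous martingale stopped at a bounded optional time are
orthogonal to the past. -/
lemma setIntegral_stopped_increment {P : Measure Ω} [IsFiniteMeasure P] {𝓕 : Filtration ℝ≥0 mΩ}
    {W : ℝ≥0 → Ω → ℝ} (hW : Martingale W 𝓕 P)
    (hrc : ∀ ω t, ContinuousWithinAt (fun r => W r ω) (Ici t) t) {τ : Ω → ℝ≥0} {T : ℝ≥0}
    (hτT : ∀ ω, τ ω ≤ T) (hτ : ∀ t, MeasurableSet[𝓕 t] {ω | τ ω < t}) {s : ℝ≥0} {F : Set Ω}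
    (hF : MeasurableSet[𝓕 s] F) :
    ∫ ω in F, (W (τ ω) ω - W (min s (τ ω)) ω) ∂P = 0 := by
  classical
  have hs : ∀ t, MeasurableSet[𝓕 t] {ω | min s (τ ω) < t} := by
    intro t
    rcases lt_or_ge s t with h | h
    · simp [h]
    · simpa [not_lt.2 h] using hτ t
  -- The time equal to τ on F and to s ∧ τ off F is again optional, since for t > s the set F is
  -- known at t, and for t ≤ s both branches give {τ < t}. Sampling W at it and at s ∧ τ gives equal
  -- means.
  have hρ : ∀ t, MeasurableSet[𝓕 t] {ω | F.piecewise τ (fun ω => min s (τ ω)) ω < t} := by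
    intro t
    rcases lt_or_ge s t with h | h
    · have : {ω | F.piecewise τ (fun ω => min s (τ ω)) ω < t} = (F ∩ {ω | τ ω < t}) ∪ Fᶜ := by
        ext ω
        by_cases hω : ω ∈ F <;> simp [hω, h]
      rw [this]
      exact ((𝓕.mono h.le _ hF).inter (hτ t)).union (𝓕.mono h.le _ hF).compl
    · have : {ω | F.piecewise τ (fun ω => min s (τ ω)) ω < t} = {ω | τ ω < t} := by
        ext ω
        by_cases hω : ω ∈ F <;> simp [hω, not_lt.2 h]
      rw [this]
      exact hτ t
  have h1 := optional_sampling hW hrc hτT hτ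
  have h2 := optional_sampling hW hrc (fun ω => (min_le_right _ _).trans (hτT ω)) hs
  have h3 := optional_sampling hW hrc (T := T) (fun ω => by
    by_cases hω : ω ∈ F
    · simpa [hω] using hτT ω
    · simpa [hω] using Or.inr (hτT ω)) hρ
  have hF' := 𝓕.le _ _ hF
  rw [← integral_indicator hF']
  have : F.indicator (fun ω => W (τ ω) ω - W (min s (τ ω)) ω) =
      fun ω => W (F.piecewise τ (fun ω => min s (τ ω)) ω) ω - W (min s (τ ω)) ω := by
    ext ω
    by_cases hω : ω ∈ F <;> simp [hω]
  rw [this, integral_sub h3.1 h2.1, h3.2, h2.2, sub_self]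

/-- A predictable martingale of finite variation vanishes at the first time its variation
exceeds a level. -/
lemma predictable_martingale_varTime {P : Measure Ω} [IsFiniteMeasure P] {𝓕 : Filtration ℝ≥0 mΩ}
    {W : ℝ≥0 → Ω → ℝ} (hpred : IsStronglyPredictable 𝓕 W) (h0 : ∀ ω, W 0 ω = 0)
    (hrc : ∀ ω t, ContinuousWithinAt (fun r => W r ω) (Ici t) t)
    (hbv : ∀ ω, LocallyBoundedVariationOn (fun r => W r ω) univ)
    (hmart : Martingale W 𝓕 P) (T : ℝ≥0) {n : ℝ} (hn : 0 ≤ n) :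
    ∀ᵐ ω ∂P, W (varTime T n fun r => W r ω) ω = 0 := by
  have hWa : ∀ t, Measurable[𝓕 t] (W t) := fun t => (hpred.stronglyAdapted t).measurable
  have hWm : ∀ t, Measurable (W t) := fun t => (hWa t).mono (𝓕.le t) le_rfl
  let S : Ω → ℝ≥0 := fun ω => varTime T n fun r => W r ω
  let v : ℝ≥0 → Ω → ℝ := fun t ω => pathVar (fun r => W r ω) t
  have hST : ∀ ω, S ω ≤ T := fun ω => varTime_le _ _ _
  have hSlt : ∀ t, MeasurableSet[𝓕 t] {ω | S ω < t} := measurableSet_varTime_lt hrc hbv hWa T n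
  have hS : Measurable S := measurable_of_Iio fun t => 𝓕.le _ _ (hSlt t)
  have hvm : ∀ t, Measurable (v t) := fun t => measurable_pathVar hrc t fun s _ => hWm s
  have hvrc : ∀ ω t, ContinuousWithinAt (fun r => v r ω) (Ici t) t := fun ω t =>
    pathVar_rightCont (hbv ω) (hrc ω) t
  have hvmono : ∀ ω, Monotone fun t => v t ω := fun ω => pathVar_mono (hbv ω)
  have hv0 : ∀ ω, v 0 ω = 0 := fun ω => pathVar_zero _
  have hvnn : ∀ t ω, 0 ≤ v t ω := fun t ω => pathVar_nonneg _ _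
  have hinc : ∀ ω s t, s ≤ t → |W t ω - W s ω| ≤ v t ω - v s ω := fun ω s t hst =>
    abs_sub_le_pathVar (hbv ω) hst
  have hvS : ∀ ω, v (S ω) ω ≤ 2 * n + |W (S ω) ω| := fun ω =>
    pathVar_le_of_lt (hbv ω) (h0 ω) hn fun u hu => pathVar_le_of_lt_varTime hu
  have hWS := (optional_sampling hmart hrc hST hSlt).1
  have hvSm : Measurable fun ω => v (S ω) ω := measurable_eval hvm hvrc hS
  have hvSi : Integrable (fun ω => v (S ω) ω) P := by
    refine Integrable.mono' ((integrable_const (2 * n)).add hWS.abs)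
      hvSm.aestronglyMeasurable (.of_forall fun ω => ?_)
    rw [Real.norm_eq_abs, abs_of_nonneg (hvnn _ _)]
    exact hvS ω
  -- c dominates the masses of dp and dq on (0, S]; the summand 1 keeps it positive, and
  -- integrability of v at S makes the measure with density c finite.
  let c : Ω → ℝ≥0 := fun ω => (1 + v (S ω) ω).toNNReal
  have hcc : ∀ ω, (c ω : ℝ) = 1 + v (S ω) ω := fun ω =>
    Real.coe_toNNReal _ (by linarith [hvnn (S ω) ω])
  have hc : Measurable c := (hvSm.const_add 1).real_toNNReal
  have hc0 : ∀ ω, 0 < c ω := fun ω => by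
    rw [← NNReal.coe_pos, hcc]
    linarith [hvnn (S ω) ω]
  have hQ : IsFiniteMeasure (P.withDensity fun ω => (c ω : ℝ≥0∞)) := by
    refine isFiniteMeasure_withDensity ?_
    have := ((integrable_const (1 : ℝ)).add hvSi).lintegral_lt_top
    exact this.ne
  -- Jordan decomposition of the path: W = p - q with p and q increasing.
  let p : ℝ≥0 → Ω → ℝ := fun t ω => (v t ω + W t ω) / 2
  let q : ℝ≥0 → Ω → ℝ := fun t ω => (v t ω - W t ω) / 2
  have hpm : ∀ t, Measurable (p t) := fun t => ((hvm t).add (hWm t)).div_const 2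
  have hqm : ∀ t, Measurable (q t) := fun t => ((hvm t).sub (hWm t)).div_const 2
  have hpmono : ∀ ω, Monotone fun t => p t ω := fun ω s t hst => by
    have := (abs_le.1 (hinc ω s t hst)).1
    simp only [p]; linarith
  have hqmono : ∀ ω, Monotone fun t => q t ω := fun ω s t hst => by
    have := (abs_le.1 (hinc ω s t hst)).2
    simp only [q]; linarith
  have hprc : ∀ ω t, ContinuousWithinAt (fun r => p r ω) (Ici t) t := fun ω t =>
    ((hvrc ω t).add (hrc ω t)).div_const 2
  have hqrc : ∀ ω t, ContinuousWithinAt (fun r => q r ω) (Ici t) t := fun ω t =>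
    ((hvrc ω t).sub (hrc ω t)).div_const 2
  have habsS : ∀ ω, |W (S ω) ω| ≤ v (S ω) ω := fun ω => by
    simpa [h0, hv0] using hinc ω 0 (S ω) zero_le
  obtain ⟨κ₁, hκ₁f, hκ₁, hκ₁S⟩ := exists_stieltjes_kernel hpm hpmono hprc hS hc hc0 fun ω => by
    rw [hcc]; simp only [p, hv0, h0]; linarith [(abs_le.1 (habsS ω)).2, hvnn (S ω) ω]
  obtain ⟨κ₂, hκ₂f, hκ₂, hκ₂S⟩ := exists_stieltjes_kernel hqm hqmono hqrc hS hc hc0 fun ω => by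
    rw [hcc]; simp only [q, hv0, h0]; linarith [(abs_le.1 (habsS ω)).1, hvnn (S ω) ω]
  have hlint : ∀ (r : ℝ≥0 → Ω → ℝ) (κ : Kernel Ω ℝ≥0) (_ : ∀ t, Measurable (r t))
      (_ : ∀ ω, Monotone fun t => r t ω)
      (_ : ∀ ω t, ContinuousWithinAt (fun u => r u ω) (Ici t) t)
      (_ : ∀ ω, r (S ω) ω - r 0 ω ≤ c ω)
      (_ : ∀ ω a b, a ≤ b → (c ω : ℝ≥0∞) * κ ω (Ioc a b) =
        ENNReal.ofReal (r (min b (S ω)) ω - r (min a (S ω)) ω))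
      (_ : ∀ ω, κ ω (Ioc 0 (S ω))ᶜ = 0) (s : ℝ≥0) (F : Set Ω) (_ : MeasurableSet F),
      Integrable (fun ω => r (S ω) ω - r (min s (S ω)) ω) P ∧
      ∫⁻ ω in F, κ ω (Ioi s) ∂(P.withDensity fun ω => (c ω : ℝ≥0∞)) =
        ENNReal.ofReal (∫ ω in F, (r (S ω) ω - r (min s (S ω)) ω) ∂P) := by
    intro r κ hrm hrmono hrrc hrc' hκ hκS s F hF
    have hnn : ∀ ω, 0 ≤ r (S ω) ω - r (min s (S ω)) ω := fun ω =>
      sub_nonneg.2 (hrmono ω (min_le_right _ _))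
    have hint : Integrable (fun ω => r (S ω) ω - r (min s (S ω)) ω) P := by
      refine Integrable.mono' ((integrable_const (1 : ℝ)).add hvSi)
        ((measurable_eval hrm hrrc hS).sub
          (measurable_eval hrm hrrc (measurable_const.min hS))).aestronglyMeasurable
        (.of_forall fun ω => ?_)
      rw [Real.norm_eq_abs, abs_of_nonneg (hnn ω)]
      have h1 := hrc' ω
      rw [hcc] at h1
      have h2 : r 0 ω ≤ r (min s (S ω)) ω := hrmono ω zero_le
      simp only [Pi.add_apply]
      linarith
    refine ⟨hint, ?_⟩
    rw [setLIntegral_withDensity_eq_setLIntegral_mul _ hc.coe_nnreal_ennreal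
      (κ.measurable_coe measurableSet_Ioi) hF,
      ofReal_integral_eq_lintegral_ofReal hint.integrableOn (.of_forall hnn)]
    refine lintegral_congr fun ω => ?_
    have h1 : κ ω (Ioi s) = κ ω (Ioc s (max s (S ω))) := by
      refine measure_congr (ae_eq_set.2 ⟨measure_mono_null ?_ (hκS ω), ?_⟩)
      · intro u hu hu'
        exact hu.2 ⟨hu.1, le_max_of_le_right hu'.2⟩
      · rw [sdiff_eq_empty.2 Ioc_subset_Ioi_self, measure_empty]
    rw [Pi.mul_apply, h1, hκ _ _ _ (le_max_left _ _), min_eq_right (le_max_right _ _)]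
  have hpc : ∀ ω, p (S ω) ω - p 0 ω ≤ c ω := fun ω => by
    rw [hcc]; simp only [p, hv0, h0]; linarith [(abs_le.1 (habsS ω)).2, hvnn (S ω) ω]
  have hqc : ∀ ω, q (S ω) ω - q 0 ω ≤ c ω := fun ω => by
    rw [hcc]; simp only [q, hv0, h0]; linarith [(abs_le.1 (habsS ω)).1, hvnn (S ω) ω]
  -- The two sides differ by the integral over F of the stopped increment of p - q = W, which is
  -- zero.
  have heq : ∀ s F, MeasurableSet[𝓕 s] F →
      ∫⁻ ω in F, κ₁ ω (Ioi s) ∂(P.withDensity fun ω => (c ω : ℝ≥0∞)) =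
      ∫⁻ ω in F, κ₂ ω (Ioi s) ∂(P.withDensity fun ω => (c ω : ℝ≥0∞)) := by
    intro s F hF
    obtain ⟨i1, e1⟩ := hlint p κ₁ hpm hpmono hprc hpc hκ₁ hκ₁S s F (𝓕.le _ _ hF)
    obtain ⟨i2, e2⟩ := hlint q κ₂ hqm hqmono hqrc hqc hκ₂ hκ₂S s F (𝓕.le _ _ hF)
    rw [e1, e2]
    congr 1
    rw [← sub_eq_zero, ← integral_sub i1.integrableOn i2.integrableOn]
    rw [← setIntegral_stopped_increment hmart hrc hST hSlt hF]
    congr 1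
    ext ω
    simp only [p, q]
    ring
  have hz : ∀ ω, κ₁ ω {0} = 0 ∧ κ₂ ω {0} = 0 := fun ω =>
    ⟨measure_mono_null (by simp) (hκ₁S ω), measure_mono_null (by simp) (hκ₂S ω)⟩
  let t : ℕ → ℕ → ℝ≥0 := fun m i => T * (i / (m + 1))
  have ht : ∀ m, Monotone (t m) := fun m i j hij => by
    simp only [t]
    gcongr
  have hδ : Tendsto (fun m : ℕ => T * (1 / ((m : ℝ≥0) + 1))) atTop (𝓝 0) := by
    simpa using tendsto_one_div_succ.const_mul T
  have htδ : ∀ m i, t m (i + 1) ≤ t m i + T * (1 / ((m : ℝ≥0) + 1)) := fun m i => by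
    simp only [t]
    rw [← mul_add, ← add_div]
    push_cast
    rfl
  have ht0 : ∀ m, t m 0 = 0 := fun m => by simp [t]
  have htT : ∀ m, t m (m + 1) = T := fun m => by
    simp only [t]
    push_cast
    rw [div_self (by positivity), mul_one]
  have hd₁ := tendsto_integral_stepSlope_sub hpred hrc hS
    (Q := P.withDensity fun ω => (c ω : ℝ≥0∞)) hκ₁S ht hδ htδ (fun m => m + 1)
  have hd₂ := tendsto_integral_stepSlope_sub hpred hrc hS
    (Q := P.withDensity fun ω => (c ω : ℝ≥0∞)) hκ₂S ht hδ htδ (fun m => m + 1)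
  -- The predictable parts cancel between the two kernels and the step parts telescope. The result
  -- does not depend on m, while each of the two integrals tends to zero.
  have hconst : ∀ m : ℕ,
      (∫ x, (stepSlope W S (t m) (m + 1) x.swap - predSlope W (t m) (m + 1) x.swap)
        ∂((P.withDensity fun ω => (c ω : ℝ≥0∞)) ⊗ₘ κ₁)) -
      (∫ x, (stepSlope W S (t m) (m + 1) x.swap - predSlope W (t m) (m + 1) x.swap)
        ∂((P.withDensity fun ω => (c ω : ℝ≥0∞)) ⊗ₘ κ₂)) =
      ∫ ω, (√(1 + W (S ω) ω ^ 2) - 1) ∂P := by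
    intro m
    have hsm := measurable_stepSlope hWm hrc hS (t m) (m + 1)
    have hpm' := (measurable_predSlope hpred (t m) (m + 1))
    have hpm'' := hpm'.mono (predictable_le_prod 𝓕) le_rfl
    obtain ⟨i1, e1⟩ := integral_stepSlope (P := P) hWm hrc hS hc hpmono hκ₁ (ht m) (m + 1)
    obtain ⟨i2, e2⟩ := integral_stepSlope (P := P) hWm hrc hS hc hqmono hκ₂ (ht m) (m + 1)
    rw [integral_sub (integrable_compProd_of_bound hsm (abs_stepSlope_le (ht m) _))
        (integrable_compProd_of_bound hpm'' (abs_predSlope_le (ht m) _)),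
      integral_sub (integrable_compProd_of_bound hsm (abs_stepSlope_le (ht m) _))
        (integrable_compProd_of_bound hpm'' (abs_predSlope_le (ht m) _)),
      integral_predictable_eq hz heq hpm', sub_sub_sub_cancel_right, e1, e2,
      ← integral_sub i1 i2]
    congr 1
    ext ω
    rw [← Finset.sum_sub_distrib]
    have : ∀ i ∈ Finset.range (m + 1),
        sqrtSlope (W (min (t m i) (S ω)) ω) (W (min (t m (i + 1)) (S ω)) ω) *
            (p (min (t m (i + 1)) (S ω)) ω - p (min (t m i) (S ω)) ω) -
          sqrtSlope (W (min (t m i) (S ω)) ω) (W (min (t m (i + 1)) (S ω)) ω) *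
            (q (min (t m (i + 1)) (S ω)) ω - q (min (t m i) (S ω)) ω) =
        √(1 + W (min (t m (i + 1)) (S ω)) ω ^ 2) - √(1 + W (min (t m i) (S ω)) ω ^ 2) := by
      intro i _
      rw [← sqrtSlope_mul_sub, ← mul_sub]
      congr 1
      simp only [p, q]
      ring
    rw [Finset.sum_congr rfl this,
      Finset.sum_range_sub (fun i => √(1 + W (min (t m i) (S ω)) ω ^ 2)), htT, ht0,
      min_eq_right (hST ω), min_eq_left zero_le, h0]
    simp
  have hzero : ∫ ω, (√(1 + W (S ω) ω ^ 2) - 1) ∂P = 0 := by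
    have := hd₁.sub hd₂
    simp only [hconst, sub_zero] at this
    exact tendsto_nhds_unique tendsto_const_nhds this
  have hnn : ∀ ω, 0 ≤ √(1 + W (S ω) ω ^ 2) - 1 := fun ω =>
    sub_nonneg.2 (one_le_sqrt_one_add_sq _)
  -- Linear growth of √(1 + x²) is why it replaces x²: W at S is only known to be integrable.
  have hle : ∀ ω, √(1 + W (S ω) ω ^ 2) - 1 ≤ |W (S ω) ω| := fun ω => by
    rw [sub_le_iff_le_add, Real.sqrt_le_left (by positivity)]
    nlinarith [abs_nonneg (W (S ω) ω), sq_abs (W (S ω) ω)]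
  have hmeas : Measurable fun ω => √(1 + W (S ω) ω ^ 2) - 1 :=
    (((measurable_eval hWm hrc hS).pow_const 2).const_add 1).sqrt.sub_const 1
  have hint : Integrable (fun ω => √(1 + W (S ω) ω ^ 2) - 1) P :=
    Integrable.mono' hWS.abs hmeas.aestronglyMeasurable (.of_forall fun ω => by
      rw [Real.norm_eq_abs, abs_of_nonneg (hnn ω)]
      exact hle ω)
  filter_upwards [(integral_eq_zero_iff_of_nonneg hnn hint).1 hzero] with ω hω
  have h1 : √(1 + W (S ω) ω ^ 2) = 1 := sub_eq_zero.1 hω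
  rw [Real.sqrt_eq_one] at h1
  exact pow_eq_zero_iff two_ne_zero |>.1 (by linarith)

/-- A predictable martingale with right-continuous paths of finite variation, null at zero,
vanishes. -/
lemma predictable_martingale_eq_zero {P : Measure Ω} [IsFiniteMeasure P]
    {𝓕 : Filtration ℝ≥0 mΩ} {W : ℝ≥0 → Ω → ℝ} (hpred : IsStronglyPredictable 𝓕 W)
    (h0 : ∀ ω, W 0 ω = 0) (hrc : ∀ ω t, ContinuousWithinAt (fun r => W r ω) (Ici t) t)
    (hbv : ∀ ω, LocallyBoundedVariationOn (fun r => W r ω) univ)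
    (hmart : Martingale W 𝓕 P) (T : ℝ≥0) : ∀ᵐ ω ∂P, W T ω = 0 := by
  have := ae_all_iff.2 fun n : ℕ =>
    predictable_martingale_varTime hpred h0 hrc hbv hmart T (Nat.cast_nonneg (α := ℝ) n)
  filter_upwards [this] with ω hω
  -- Once n exceeds the variation of this path up to T, the stopping time equals T.
  obtain ⟨n, hn⟩ := exists_nat_ge (pathVar (fun r => W r ω) T)
  have h := hω n
  rwa [varTime_eq (hbv ω) hn] at h

end CylMVM

/-! ### Uniqueness of compensators, and of random measures given on rectangles. -/

namespace CylMVM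

lemma locallyBoundedVariationOn_add {α : Type*} [LinearOrder α] {f g : α → ℝ} {s : Set α}
    (hf : LocallyBoundedVariationOn f s) (hg : LocallyBoundedVariationOn g s) :
    LocallyBoundedVariationOn (fun x => f x + g x) s := by
  intro a b ha hb
  refine ne_top_of_le_ne_top (ENNReal.add_ne_top.2 ⟨hf a b ha hb, hg a b ha hb⟩) ?_
  refine iSup_le fun ⟨n, u, hu, hus⟩ => ?_
  calc _ ≤ ∑ i ∈ Finset.range n, (edist (f (u (i + 1))) (f (u i)) +
        edist (g (u (i + 1))) (g (u i))) := Finset.sum_le_sum fun i _ => edist_add_add_le _ _ _ _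
    _ ≤ _ := by
      rw [Finset.sum_add_distrib]
      exact add_le_add (eVariationOn.sum_le hu hus) (eVariationOn.sum_le hu hus)

lemma locallyBoundedVariationOn_const_mul {α : Type*} [LinearOrder α] {f : α → ℝ} {s : Set α}
    (hf : LocallyBoundedVariationOn f s) (c : ℝ) :
    LocallyBoundedVariationOn (fun x => c * f x) s :=
  (LipschitzWith.of_dist_le_mul (K := ‖c‖₊) fun x y => by
    rw [Real.dist_eq, Real.dist_eq, ← mul_sub, abs_mul]; rfl :
    LipschitzWith ‖c‖₊ fun x : ℝ => c * x).comp_locallyBoundedVariationOn hf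

section Compensator

variable {Ω : Type*} [mΩ : MeasurableSpace Ω]

/-- `V` is a predictable compensator of `R`, of finite variation. -/
structure IsCompensator (P : Measure Ω) (𝓕 : Filtration ℝ≥0 mΩ) (R V : ℝ≥0 → Ω → ℝ) : Prop where
  predictable : IsStronglyPredictable 𝓕 V
  zero : ∀ᵐ ω ∂P, V 0 ω = 0
  rightCont : ∀ᵐ ω ∂P, ∀ t, ContinuousWithinAt (fun r => V r ω) (Ici t) t
  finiteVariation : ∀ᵐ ω ∂P, LocallyBoundedVariationOn (fun r => V r ω) univ
  martingale : Martingale (fun t ω => R t ω - V t ω) 𝓕 P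

variable {P : Measure Ω} {𝓕 : Filtration ℝ≥0 mΩ} {R R' V V' Y Z : ℝ≥0 → Ω → ℝ}

lemma isQuadCov_iff_isCompensator :
    IsQuadCov P 𝓕 Y Z V ↔ IsCompensator P 𝓕 (fun t ω => Y t ω * Z t ω) V :=
  ⟨fun h => ⟨h.1, h.2, h.3, h.4, h.5⟩, fun h => ⟨h.1, h.2, h.3, h.4, h.5⟩⟩

lemma martingale_congr {f g : ℝ≥0 → Ω → ℝ} (hf : Martingale f 𝓕 P) (hg : StronglyAdapted 𝓕 g)
    (h : ∀ t, f t =ᵐ[P] g t) : Martingale g 𝓕 P :=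
  ⟨hg, fun i j hij => (condExp_congr_ae (h j).symm).trans ((hf.2 i j hij).trans (h i))⟩

lemma IsCompensator.congr (h : IsCompensator P 𝓕 R V) (hR' : StronglyAdapted 𝓕 R')
    (hRR' : ∀ t, R t =ᵐ[P] R' t) : IsCompensator P 𝓕 R' V where
  predictable := h.predictable
  zero := h.zero
  rightCont := h.rightCont
  finiteVariation := h.finiteVariation
  martingale := martingale_congr h.martingale
    (fun t => (hR' t).sub (h.predictable.stronglyAdapted t)) fun t => by
      filter_upwards [hRR' t] with ω hω
      rw [hω]

lemma IsCompensator.add (h : IsCompensator P 𝓕 R V) (h' : IsCompensator P 𝓕 R' V') :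
    IsCompensator P 𝓕 (fun t ω => R t ω + R' t ω) (fun t ω => V t ω + V' t ω) where
  predictable := StronglyMeasurable.add h.predictable h'.predictable
  zero := by filter_upwards [h.zero, h'.zero] with ω h1 h2 using by rw [h1, h2, add_zero]
  rightCont := by
    filter_upwards [h.rightCont, h'.rightCont] with ω h1 h2 t using (h1 t).add (h2 t)
  finiteVariation := by
    filter_upwards [h.finiteVariation, h'.finiteVariation] with ω h1 h2 using
      locallyBoundedVariationOn_add h1 h2
  martingale := by
    convert h.martingale.add h'.martingale using 1
    ext t ω
    simp only [Pi.add_apply]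
    ring

lemma IsCompensator.const_mul (h : IsCompensator P 𝓕 R V) (c : ℝ) :
    IsCompensator P 𝓕 (fun t ω => c * R t ω) (fun t ω => c * V t ω) where
  predictable := StronglyMeasurable.const_mul h.predictable c
  zero := by filter_upwards [h.zero] with ω h1 using by rw [h1, mul_zero]
  rightCont := by filter_upwards [h.rightCont] with ω h1 t using (h1 t).const_mul c
  finiteVariation := by
    filter_upwards [h.finiteVariation] with ω h1
    exact locallyBoundedVariationOn_const_mul h1 c
  martingale := by
    convert h.martingale.smul c using 1
    ext t ω
    simp only [Pi.smul_apply, smul_eq_mul]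
    ring

lemma measurableSet_predictable_univ_prod {A : Set Ω} (hA : MeasurableSet[𝓕 0] A) :
    MeasurableSet[𝓕.predictable] ((univ : Set ℝ≥0) ×ˢ A) := by
  have : (univ : Set ℝ≥0) ×ˢ A = {⊥} ×ˢ A ∪ Ioi 0 ×ˢ A := by
    ext ⟨t, ω⟩
    rcases eq_or_ne t 0 with h | h
    · simp [h]
    · simp [h, pos_iff_ne_zero]
  rw [this]
  exact (measurableSet_predictable_singleton_bot_prod hA).union
    (measurableSet_predictable_Ioi_prod hA)

/-- Uniqueness of the predictable compensator. -/
lemma IsCompensator.unique [IsFiniteMeasure P]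
    (h𝓕 : ∀ N : Set Ω, P N = 0 → MeasurableSet[𝓕 0] N)
    (h : IsCompensator P 𝓕 R V) (h' : IsCompensator P 𝓕 R V') (t : ℝ≥0) :
    V t =ᵐ[P] V' t := by
  classical
  -- The path properties hold only almost surely. The exceptional set is null, hence in 𝓕 0, so
  -- setting the process to zero there preserves predictability and regularizes every path.
  let good : Set Ω := {ω | V 0 ω - V' 0 ω = 0 ∧
    (∀ t, ContinuousWithinAt (fun r => V r ω - V' r ω) (Ici t) t) ∧
    LocallyBoundedVariationOn (fun r => V r ω - V' r ω) univ}
  have hgood : ∀ᵐ ω ∂P, ω ∈ good := by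
    filter_upwards [h.zero, h'.zero, h.rightCont, h'.rightCont, h.finiteVariation,
      h'.finiteVariation] with ω h1 h2 h3 h4 h5 h6
    exact ⟨by rw [h1, h2, sub_zero], fun t => (h3 t).sub (h4 t), by
      simpa [sub_eq_add_neg] using
        locallyBoundedVariationOn_add h5 (locallyBoundedVariationOn_const_mul h6 (-1))⟩
  have hg0 : MeasurableSet[𝓕 0] good := by
    rw [← compl_compl good]
    exact (h𝓕 _ hgood).compl
  let W : ℝ≥0 → Ω → ℝ := fun t => good.indicator fun ω => V t ω - V' t ω
  have hWae : ∀ t, (fun ω => V t ω - V' t ω) =ᵐ[P] W t := fun t => by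
    filter_upwards [hgood] with ω hω
    simp [W, hω]
  have hpred : IsStronglyPredictable 𝓕 W := by
    have := (StronglyMeasurable.sub h.predictable h'.predictable).indicator
      (measurableSet_predictable_univ_prod hg0)
    have hW : Function.uncurry W =
        ((univ : Set ℝ≥0) ×ˢ good).indicator (Function.uncurry V - Function.uncurry V') := by
      ext ⟨s, ω⟩
      by_cases hω : ω ∈ good <;> simp [W, hω]
    rw [IsStronglyPredictable, hW]
    exact this
  have hmart : Martingale W 𝓕 P := by
    refine martingale_congr (f := fun t ω => V t ω - V' t ω) ?_ hpred.stronglyAdapted hWae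
    convert h'.martingale.sub h.martingale using 1
    ext s ω
    simp only [Pi.sub_apply]
    ring
  have key := predictable_martingale_eq_zero hpred (fun ω => ?_) (fun ω s => ?_) (fun ω => ?_)
    hmart t
  · filter_upwards [hWae t, key] with ω h1 h2
    exact sub_eq_zero.1 (h1.trans h2)
  · by_cases hω : ω ∈ good
    · simpa [W, hω] using hω.1
    · simp [W, hω]
  · by_cases hω : ω ∈ good
    · simpa [W, hω] using hω.2.1 s
    · simpa [W, hω] using continuousWithinAt_const
  · by_cases hω : ω ∈ good
    · simpa [W, hω] using hω.2.2
    · simp only [W, hω, not_false_eq_true, indicator_of_notMem]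
      exact fun a b _ _ => by
        rw [BoundedVariationOn, eVariationOn.constant_on]
        · simp
        · exact (subsingleton_singleton (a := (0 : ℝ))).anti (by rintro _ ⟨_, _, rfl⟩; rfl)

end Compensator

/-- Random measures on `ℝ₊ × U` that agree almost surely on each rectangle, and are finite there,
agree almost surely. -/
lemma ae_measure_eq_of_rect {Ω U : Type*} [MeasurableSpace Ω] {P : Measure Ω}
    [MeasurableSpace U] [MeasurableSpace.CountablyGenerated U] {E : ℕ → Set U}
    (hEU : (⋃ n, E n) = univ) (hEm : Monotone E) (hE : ∀ n, MeasurableSet (E n))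
    {μ₁ μ₂ : Ω → Measure (ℝ≥0 × U)}
    (h : ∀ n, ∀ B, MeasurableSet B → B ⊆ E n → ∀ t : ℝ≥0, ∀ᵐ ω ∂P,
      μ₁ ω (Icc 0 t ×ˢ B) ≠ ∞ ∧ μ₁ ω (Icc 0 t ×ˢ B) = μ₂ ω (Icc 0 t ×ˢ B)) :
    ∀ᵐ ω ∂P, μ₁ ω = μ₂ ω := by
  -- A countable algebra generating the σ-algebra of U, traced on the E n, together with countably
  -- many times, gives a countable π-system of rectangles of finite measure, so one null set serves
  -- them all.
  let 𝒞 := generateSetAlgebra (MeasurableSpace.countableGeneratingSet U)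
  have h𝒞c : 𝒞.Countable :=
    countable_generateSetAlgebra MeasurableSpace.countable_countableGeneratingSet
  have h𝒞 : IsSetAlgebra 𝒞 := isSetAlgebra_generateSetAlgebra
  have h𝒞g : MeasurableSpace.generateFrom 𝒞 = ‹MeasurableSpace U› := by
    rw [generateFrom_generateSetAlgebra_eq, MeasurableSpace.generateFrom_countableGeneratingSet]
  have h𝒞m : ∀ a ∈ 𝒞, MeasurableSet a := fun a ha => by
    rw [← h𝒞g]
    exact MeasurableSpace.measurableSet_generateFrom ha
  let r : ℕ → ℝ≥0 := TopologicalSpace.denseSeq ℝ≥0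
  have hr : DenseRange r := TopologicalSpace.denseRange_denseSeq _
  let 𝒟 : Set (Set ℝ≥0) := range fun k => Icc 0 (r k)
  let 𝒰 : Set (Set U) := {s | ∃ n, ∃ a ∈ 𝒞, s = a ∩ E n}
  have hall : ∀ᵐ ω ∂P, ∀ a ∈ 𝒞, ∀ n k, μ₁ ω (Icc 0 (r k) ×ˢ (a ∩ E n)) ≠ ∞ ∧
      μ₁ ω (Icc 0 (r k) ×ˢ (a ∩ E n)) = μ₂ ω (Icc 0 (r k) ×ˢ (a ∩ E n)) := by
    rw [ae_ball_iff h𝒞c]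
    intro a ha
    rw [ae_all_iff]
    intro n
    rw [ae_all_iff]
    exact fun k => h n _ ((h𝒞m a ha).inter (hE n)) inter_subset_right _
  have hgt : ∀ u, ∃ k, u < r k := fun u => by
    obtain ⟨_, ⟨k, rfl⟩, h1, -⟩ := hr.exists_between (lt_add_one u)
    exact ⟨k, h1⟩
  have h𝒟g : MeasurableSpace.generateFrom 𝒟 = (inferInstance : MeasurableSpace ℝ≥0) := by
    refine le_antisymm (MeasurableSpace.generateFrom_le ?_) ?_
    · rintro _ ⟨k, rfl⟩
      exact measurableSet_Icc
    · rw [BorelSpace.measurable_eq (α := ℝ≥0), borel_eq_generateFrom_Iic]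
      refine MeasurableSpace.generateFrom_le ?_
      rintro _ ⟨t, rfl⟩
      have : Iic t = ⋂ (k) (_ : t ≤ r k), Icc 0 (r k) := by
        ext u
        simp only [mem_Iic, mem_iInter, mem_Icc, zero_le, true_and]
        refine ⟨fun hu k hk => hu.trans hk, fun hu => ?_⟩
        by_contra! hlt
        obtain ⟨_, ⟨k, rfl⟩, h1, h2⟩ := hr.exists_between hlt
        exact (hu k h1.le).not_gt h2
      rw [this]
      exact MeasurableSet.iInter fun k => MeasurableSet.iInter fun _ =>
        MeasurableSpace.measurableSet_generateFrom ⟨k, rfl⟩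
  have h𝒰g : MeasurableSpace.generateFrom 𝒰 = ‹MeasurableSpace U› := by
    refine le_antisymm (MeasurableSpace.generateFrom_le ?_) ?_
    · rintro _ ⟨n, a, ha, rfl⟩
      exact (h𝒞m a ha).inter (hE n)
    · conv_lhs => rw [← h𝒞g]
      refine MeasurableSpace.generateFrom_le fun a ha => ?_
      rw [← inter_univ a, ← hEU, inter_iUnion]
      exact MeasurableSet.iUnion fun n =>
        MeasurableSpace.measurableSet_generateFrom ⟨n, a, ha, rfl⟩
  have h𝒟s : IsCountablySpanning 𝒟 := ⟨fun k => Icc 0 (r k), fun k => ⟨k, rfl⟩, by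
    refine eq_univ_of_forall fun u => ?_
    obtain ⟨k, hk⟩ := hgt u
    exact mem_iUnion.2 ⟨k, zero_le, hk.le⟩⟩
  have h𝒰s : IsCountablySpanning 𝒰 := ⟨E, fun n => ⟨n, univ, h𝒞.univ_mem, by simp⟩, hEU⟩
  have hgen := generateFrom_prod_eq h𝒟s h𝒰s
  rw [h𝒟g, h𝒰g] at hgen
  have hπ : IsPiSystem (image2 (· ×ˢ ·) 𝒟 𝒰) := by
    rintro _ ⟨_, ⟨k, rfl⟩, _, ⟨n, a, ha, rfl⟩, rfl⟩ _ ⟨_, ⟨l, rfl⟩, _, ⟨m, b, hb, rfl⟩, rfl⟩ -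
    -- The intersection must again end at a listed time, so the index attaining the smaller of r k
    -- and r l is chosen.
    refine ⟨_, ⟨if r k ≤ r l then k else l, rfl⟩, _, ⟨min n m, a ∩ b, h𝒞.inter_mem ha hb, rfl⟩, ?_⟩
    have h1 : E (min n m) = E n ∩ E m := by
      rcases le_total n m with h | h
      · rw [min_eq_left h, inter_eq_left.2 (hEm h)]
      · rw [min_eq_right h, inter_eq_right.2 (hEm h)]
    have h2 : r (if r k ≤ r l then k else l) = min (r k) (r l) := by
      rcases le_total (r k) (r l) with h | h
      · simp [h]
      · rcases h.eq_or_lt with h' | h'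
        · simp [h']
        · simp [h'.not_ge, h]
    simp only [h1, h2, prod_inter_prod, Icc_inter_Icc]
    rw [inter_inter_inter_comm]
    simp
  filter_upwards [hall] with ω hω
  refine Measure.ext_of_generateFrom_of_iUnion _
    (fun k => Icc 0 (r k.unpair.1) ×ˢ E k.unpair.2) hgen hπ ?_ ?_ ?_ ?_
  · refine eq_univ_of_forall fun ⟨u, x⟩ => ?_
    obtain ⟨k, hk⟩ := hgt u
    obtain ⟨n, hn⟩ := mem_iUnion.1 (hEU ▸ mem_univ x : x ∈ ⋃ n, E n)
    exact mem_iUnion.2 ⟨Nat.pair k n, by simpa using ⟨hk.le, hn⟩⟩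
  · exact fun k => ⟨_, ⟨_, rfl⟩, _, ⟨_, univ, h𝒞.univ_mem, (univ_inter _).symm⟩, rfl⟩
  · intro k
    simpa using (hω univ h𝒞.univ_mem k.unpair.2 k.unpair.1).1
  · rintro _ ⟨_, ⟨k, rfl⟩, _, ⟨n, a, ha, rfl⟩, rfl⟩
    exact (hω a ha n k).2

end CylMVM

/-! ### Polarization on groups and extension of bounded forms by continuity. -/

namespace CylMVM

section Polarization

/-- The polarization of a real function satisfying the parallelogram law on a group. -/
noncomputable def polarHom {A : Type*} [AddCommGroup A] (q : A → ℝ)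
    (hq : ∀ x y, q (x + y) + q (x - y) = 2 * q x + 2 * q y) : A →+ A →+ ℝ :=
  have h0 : q 0 = 0 := by have := hq 0 0; simp at this; linarith
  have hneg : ∀ x, q (-x) = q x := fun x => by
    have := hq 0 x; simp only [zero_add, zero_sub, h0] at this; linarith
  have hsymm : ∀ x y, q (x - y) = q (y - x) := fun x y => by rw [← hneg, neg_sub]
  have hadd : ∀ x y z, (q (x + y + z) - q (x + y - z)) =
      (q (x + z) - q (x - z)) + (q (y + z) - q (y - z)) := fun x y z => by
    have h1 : ∀ u w, (q (u + w + z) - q (u + w - z)) + (q (u - w + z) - q (u - w - z)) =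
        2 * (q (u + z) - q (u - z)) := fun u w => by
      have e1 := hq (u + z) w
      have e2 := hq (u - z) w
      rw [show u + z + w = u + w + z by abel, show u + z - w = u - w + z by abel] at e1
      rw [show u - z + w = u + w - z by abel, show u - z - w = u - w - z by abel] at e2
      linarith
    have h2 : ∀ u, (q (u + u + z) - q (u + u - z)) = 2 * (q (u + z) - q (u - z)) := fun u => by
      have := h1 u u
      simp only [sub_self, zero_add, zero_sub, hneg] at this
      linarith
    -- The Jordan–von Neumann substitution: the sum and difference of x + y and x - y are 2x and 2y,
    -- to which the doubling identity `h2` applies.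
    have h3 := h1 (x + y) (x - y)
    rw [show x + y + (x - y) = x + x by abel, show x + y - (x - y) = y + y by abel, h2, h2] at h3
    linarith
  AddMonoidHom.mk' (fun x => AddMonoidHom.mk' (fun y => (q (x + y) - q (x - y)) / 4) fun y z => by
      have := hadd y z x
      rw [hsymm x, hsymm x, hsymm x, add_comm x, add_comm x y, add_comm x z]
      linarith) fun x y => by
    ext z
    have := hadd x y z
    simp only [AddMonoidHom.mk'_apply, AddMonoidHom.add_apply]
    linarith

variable {A : Type*} [AddCommGroup A] {q : A → ℝ}
  (hq : ∀ x y, q (x + y) + q (x - y) = 2 * q x + 2 * q y)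

lemma polarHom_apply (x y : A) : polarHom q hq x y = (q (x + y) - q (x - y)) / 4 := rfl

include hq in
lemma parallelogram_zero : q 0 = 0 := by have := hq 0 0; simp at this; linarith

lemma polarHom_self (x : A) : polarHom q hq x x = q x := by
  have h := hq x x
  rw [sub_self, parallelogram_zero hq] at h
  rw [polarHom_apply, sub_self, parallelogram_zero hq]
  linarith

lemma polarHom_symm (x y : A) : polarHom q hq x y = polarHom q hq y x := by
  have h1 := hq x y
  have h2 := hq y x
  rw [polarHom_apply, polarHom_apply]
  rw [add_comm y x] at *
  linarith

/-- On a group only integer multiples exist, so q (n x + m y) ≥ 0 gives a quadratic polynomial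
nonnegative at the rationals. Density extends this to the reals, and the discriminant gives
Cauchy–Schwarz. -/
lemma polarHom_sq_le (hnn : ∀ x, 0 ≤ q x) (x y : A) : polarHom q hq x y ^ 2 ≤ q x * q y := by
  set b := polarHom q hq x y
  have hint : ∀ (n : ℤ) (m : ℤ), 0 ≤ n ^ 2 * q x + 2 * n * m * b + m ^ 2 * q y := fun n m => by
    have h := hnn (n • x + m • y)
    rw [← polarHom_self hq] at h
    simp only [map_add, map_zsmul, AddMonoidHom.add_apply, AddMonoidHom.coe_smul, Pi.smul_apply,
      polarHom_self, polarHom_symm hq y x, zsmul_eq_mul] at h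
    calc 0 ≤ _ := h
      _ = _ := by ring
  have hrat : ∀ r : ℚ, 0 ≤ q x * ((r : ℝ) * r) + 2 * b * r + q y := fun r => by
    have h := hint r.num r.den
    have hd : (0 : ℝ) < r.den := by exact_mod_cast r.den_pos
    have hr : (r : ℝ) = r.num / r.den := by exact_mod_cast (Rat.num_div_den r).symm
    have : q x * ((r : ℝ) * r) + 2 * b * r + q y =
        (r.num ^ 2 * q x + 2 * r.num * r.den * b + r.den ^ 2 * q y) / (r.den : ℝ) ^ 2 := by
      rw [hr]
      field_simp
    rw [this]
    exact div_nonneg (by exact_mod_cast h) (by positivity)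
  have hreal : ∀ r : ℝ, 0 ≤ q x * (r * r) + 2 * b * r + q y := fun r =>
    Rat.denseRange_cast.induction_on (p := fun r : ℝ => 0 ≤ q x * (r * r) + 2 * b * r + q y) r
      (isClosed_le (by fun_prop) (by fun_prop)) hrat
  have := discrim_le_zero hreal
  rw [discrim] at this
  nlinarith

end Polarization

section Extension

variable {E : Type*} [NormedAddCommGroup E] [NormedSpace ℝ E]

/-- A bounded form satisfying the parallelogram law on a dense subgroup extends to a bounded
bilinear form. -/
lemma exists_bilinear_extension {G : AddSubgroup E} (hG : Dense (G : Set E)) {q : E → ℝ} {c : ℝ}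
    (hc : 0 ≤ c) (hq : ∀ x ∈ G, ∀ y ∈ G, q (x + y) + q (x - y) = 2 * q x + 2 * q y)
    (hnn : ∀ x ∈ G, 0 ≤ q x) (hle : ∀ x ∈ G, q x ≤ c * ‖x‖ ^ 2) :
    ∃ B : E →L[ℝ] E →L[ℝ] ℝ, (∀ x ∈ G, ∀ y ∈ G, B x y = (q (x + y) - q (x - y)) / 4) ∧
      ‖B‖ ≤ c := by
  let q' : G → ℝ := fun x => q x
  have hq' : ∀ x y : G, q' (x + y) + q' (x - y) = 2 * q' x + 2 * q' y := fun x y =>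
    hq x x.2 y y.2
  let φ := polarHom q' hq'
  have hφ : ∀ x y : G, |φ x y| ≤ c * ‖x‖ * ‖y‖ := fun x y => by
    refine abs_le_of_sq_le_sq ((polarHom_sq_le hq' (fun x => hnn x x.2) x y).trans ?_)
      (by positivity)
    calc q x * q y ≤ (c * ‖(x : E)‖ ^ 2) * (c * ‖(y : E)‖ ^ 2) :=
          mul_le_mul (hle x x.2) (hle y y.2) (hnn y y.2) (by positivity)
      _ = (c * ‖x‖ * ‖y‖) ^ 2 := by rw [AddSubgroup.coe_norm, AddSubgroup.coe_norm]; ring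
  have hφc : Continuous fun p : G × G => φ p.1 p.2 := by
    rw [continuous_iff_continuousAt]
    rintro ⟨x, y⟩
    rw [ContinuousAt, tendsto_iff_norm_sub_tendsto_zero]
    have hlim : Tendsto (fun p : G × G => c * ‖p.1 - x‖ * ‖p.2‖ + c * ‖x‖ * ‖p.2 - y‖)
        (𝓝 (x, y)) (𝓝 0) := by
      have : Continuous fun p : G × G => c * ‖p.1 - x‖ * ‖p.2‖ + c * ‖x‖ * ‖p.2 - y‖ := by
        fun_prop
      simpa using this.tendsto (x, y)
    refine squeeze_zero (fun _ => norm_nonneg _) (fun p => ?_) hlim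
    have : φ p.1 p.2 - φ x y = φ (p.1 - x) p.2 + φ x (p.2 - y) := by
      simp only [map_sub, AddMonoidHom.sub_apply]
      ring
    rw [this]
    exact (norm_add_le _ _).trans (add_le_add (hφ _ _) (hφ _ _))
  have de : IsDenseInducing (G.subtype : G →+ E) := hG.isDenseInducing_val
  let β : E × E → ℝ := (de.prodMap de).extend fun p : G × G => φ p.1 p.2
  have hβc : Continuous β := de.extend_Z_bilin de hφc
  have hβ : ∀ x y : G, β (x, y) = φ x y := fun x y =>
    (de.prodMap de).extend_eq hφc (x, y)
  have ext1 : ∀ {p : E → Prop}, IsClosed {x | p x} → (∀ x ∈ G, p x) → ∀ x, p x :=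
    fun hp h x => isClosed_property hG.denseRange_val hp (fun a => h a a.2) x
  have hadd1 : ∀ x y z, β (x + y, z) = β (x, z) + β (y, z) := by
    intro x y z
    refine ext1 (p := fun x => β (x + y, z) = β (x, z) + β (y, z))
      (isClosed_eq (by fun_prop) (by fun_prop)) (fun x hx => ?_) x
    refine ext1 (p := fun y => β (x + y, z) = β (x, z) + β (y, z))
      (isClosed_eq (by fun_prop) (by fun_prop)) (fun y hy => ?_) y
    refine ext1 (p := fun z => β (x + y, z) = β (x, z) + β (y, z))
      (isClosed_eq (by fun_prop) (by fun_prop)) (fun z hz => ?_) z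
    have e := hβ (⟨x, hx⟩ + ⟨y, hy⟩) ⟨z, hz⟩
    rw [map_add, AddMonoidHom.add_apply, ← hβ, ← hβ] at e
    exact e
  have hsymm : ∀ x y, β (x, y) = β (y, x) := by
    intro x y
    refine ext1 (p := fun x => β (x, y) = β (y, x))
      (isClosed_eq (by fun_prop) (by fun_prop)) (fun x hx => ?_) x
    refine ext1 (p := fun y => β (x, y) = β (y, x))
      (isClosed_eq (by fun_prop) (by fun_prop)) (fun y hy => ?_) y
    have e1 := hβ ⟨x, hx⟩ ⟨y, hy⟩
    have e2 := hβ ⟨y, hy⟩ ⟨x, hx⟩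
    rw [show φ ⟨x, hx⟩ ⟨y, hy⟩ = φ ⟨y, hy⟩ ⟨x, hx⟩ from polarHom_symm hq' _ _] at e1
    exact e1.trans e2.symm
  have hbound : ∀ x y, |β (x, y)| ≤ c * ‖x‖ * ‖y‖ := by
    intro x y
    refine ext1 (p := fun x => |β (x, y)| ≤ c * ‖x‖ * ‖y‖)
      (isClosed_le (by fun_prop) (by fun_prop)) (fun x hx => ?_) x
    refine ext1 (p := fun y => |β (x, y)| ≤ c * ‖x‖ * ‖y‖)
      (isClosed_le (by fun_prop) (by fun_prop)) (fun y hy => ?_) y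
    have e1 := hβ ⟨x, hx⟩ ⟨y, hy⟩
    have e2 := hφ ⟨x, hx⟩ ⟨y, hy⟩
    rw [← e1] at e2
    exact e2
  have hadd2 : ∀ x y z, β (x, y + z) = β (x, y) + β (x, z) := fun x y z => by
    rw [hsymm, hadd1, hsymm y, hsymm z]
  -- The subgroup is not closed under real scalars; homogeneity comes from additivity and continuity
  -- of the extension.
  have hsmul1 : ∀ (r : ℝ) x y, β (r • x, y) = r * β (x, y) := fun r x y =>
    map_real_smul (AddMonoidHom.mk' (fun x => β (x, y)) fun a b => hadd1 a b y)
      (show Continuous fun x => β (x, y) by fun_prop) r x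
  have hsmul2 : ∀ (r : ℝ) x y, β (x, r • y) = r * β (x, y) := fun r x y => by
    rw [hsymm, hsmul1, hsymm]
  refine ⟨LinearMap.mkContinuous₂ (LinearMap.mk₂ ℝ (fun x y => β (x, y)) hadd1 hsmul1 hadd2
    hsmul2) c hbound, fun x hx y hy => ?_, LinearMap.mkContinuous₂_norm_le _ hc _⟩
  exact hβ ⟨x, hx⟩ ⟨y, hy⟩

lemma bilinear_ext_of_dense {G : AddSubgroup E} (hG : Dense (G : Set E))
    {B B' : E →L[ℝ] E →L[ℝ] ℝ} (h : ∀ x ∈ G, ∀ y ∈ G, B x y = B' x y) : B = B' := by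
  ext x y
  have hc : ∀ B : E →L[ℝ] E →L[ℝ] ℝ, Continuous fun p : E × E => B p.1 p.2 := fun B => by
    fun_prop
  have := Continuous.ext_on (hG.prod hG) (hc B) (hc B') fun p hp => h _ hp.1 _ hp.2
  exact congrFun this (x, y)

end Extension

end CylMVM

/-! ### Quadratic families of measures and their bilinear forms. -/

namespace CylMVM

section QuadFam

variable {E S : Type*} [NormedAddCommGroup E] [NormedSpace ℝ E] [MeasurableSpace S]

/-- A family of measures that is a quadratic form on a subgroup, bounded by the measure `η`. -/
structure QuadFam (G : AddSubgroup E) (m : E → Measure S) (η : Measure S) : Prop where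
  par : ∀ x ∈ G, ∀ y ∈ G, m (x + y) + m (x - y) = (2 : ℝ≥0∞) • m x + (2 : ℝ≥0∞) • m y
  le : ∀ x ∈ G, m x ≤ ENNReal.ofReal (‖x‖ ^ 2) • η

open scoped Classical in
/-- The bounded bilinear form extending the polarization of `x ↦ m x C` from the subgroup `G`. -/
noncomputable def bilOf (G : AddSubgroup E) (m : E → Measure S) (C : Set S) : E →L[ℝ] E →L[ℝ] ℝ :=
  if h : ∃ B : E →L[ℝ] E →L[ℝ] ℝ, ∀ x ∈ G, ∀ y ∈ G,
    B x y = ((m (x + y) C).toReal - (m (x - y) C).toReal) / 4 then h.choose else 0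

variable {G H : AddSubgroup E} {m : E → Measure S} {η : Measure S} {C : Set S}

omit [NormedSpace ℝ E] in
lemma QuadFam.ne_top (hQ : QuadFam G m η) (hC : η C ≠ ∞) {x : E} (hx : x ∈ G) : m x C ≠ ∞ :=
  ne_top_of_le_ne_top (ENNReal.mul_ne_top ENNReal.ofReal_ne_top hC)
    (hQ.le x hx C)

lemma QuadFam.exists_bilinear (hQ : QuadFam G m η) (hG : Dense (G : Set E)) (hC : η C ≠ ∞) :
    ∃ B : E →L[ℝ] E →L[ℝ] ℝ, (∀ x ∈ G, ∀ y ∈ G,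
      B x y = ((m (x + y) C).toReal - (m (x - y) C).toReal) / 4) ∧ ‖B‖ ≤ (η C).toReal := by
  refine exists_bilinear_extension (q := fun x => (m x C).toReal) hG ENNReal.toReal_nonneg
    (fun x hx y hy => ?_) (fun _ _ => ENNReal.toReal_nonneg) fun x hx => ?_
  · have h := congrArg (fun μ : Measure S => (μ C).toReal) (hQ.par x hx y hy)
    simp only [Measure.add_apply, Measure.smul_apply, smul_eq_mul] at h
    rw [ENNReal.toReal_add (hQ.ne_top hC (G.add_mem hx hy)) (hQ.ne_top hC (G.sub_mem hx hy)),
      ENNReal.toReal_add (ENNReal.mul_ne_top (by simp) (hQ.ne_top hC hx))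
        (ENNReal.mul_ne_top (by simp) (hQ.ne_top hC hy)), ENNReal.toReal_mul,
      ENNReal.toReal_mul] at h
    simpa using h
  · have h := ENNReal.toReal_mono (ENNReal.mul_ne_top ENNReal.ofReal_ne_top hC)
      (hQ.le x hx C)
    rw [ENNReal.toReal_mul,
      ENNReal.toReal_ofReal (by positivity), mul_comm] at h
    exact h

lemma QuadFam.bilOf_apply (hQ : QuadFam G m η) (hG : Dense (G : Set E)) (hC : η C ≠ ∞)
    {x y : E} (hx : x ∈ G) (hy : y ∈ G) :
    bilOf G m C x y = ((m (x + y) C).toReal - (m (x - y) C).toReal) / 4 := by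
  have h : ∃ B : E →L[ℝ] E →L[ℝ] ℝ, ∀ x ∈ G, ∀ y ∈ G,
      B x y = ((m (x + y) C).toReal - (m (x - y) C).toReal) / 4 :=
    (hQ.exists_bilinear hG hC).imp fun _ h => h.1
  rw [bilOf, dif_pos h]
  exact h.choose_spec x hx y hy

lemma QuadFam.bilOf_eq (hQ : QuadFam G m η) (hG : Dense (G : Set E)) (hC : η C ≠ ∞)
    {B : E →L[ℝ] E →L[ℝ] ℝ}
    (hB : ∀ x ∈ G, ∀ y ∈ G, B x y = ((m (x + y) C).toReal - (m (x - y) C).toReal) / 4) :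
    bilOf G m C = B :=
  bilinear_ext_of_dense hG fun x hx y hy => by rw [hQ.bilOf_apply hG hC hx hy, hB x hx y hy]

lemma QuadFam.norm_bilOf_le (hQ : QuadFam G m η) (hG : Dense (G : Set E)) (hC : η C ≠ ∞) :
    ‖bilOf G m C‖ ≤ (η C).toReal := by
  obtain ⟨B, hB, hB'⟩ := hQ.exists_bilinear hG hC
  rwa [hQ.bilOf_eq hG hC hB]

lemma QuadFam.bilOf_self (hQ : QuadFam G m η) (hG : Dense (G : Set E)) (hC : η C ≠ ∞)
    {x : E} (hx : x ∈ G) : bilOf G m C x x = (m x C).toReal := by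
  have h := congrArg (fun μ : Measure S => (μ C).toReal) (hQ.par x hx x hx)
  have h0 := congrArg (fun μ : Measure S => (μ C).toReal) (hQ.par 0 G.zero_mem 0 G.zero_mem)
  simp only [Measure.add_apply, Measure.smul_apply, smul_eq_mul, ← two_mul, add_zero,
    sub_self, ENNReal.toReal_mul, ENNReal.toReal_ofNat] at h h0
  rw [ENNReal.toReal_add (hQ.ne_top hC (G.add_mem hx hx)) (hQ.ne_top hC G.zero_mem)] at h
  rw [hQ.bilOf_apply hG hC hx hx, sub_self]
  linarith

lemma QuadFam.bilOf_symm (hQ : QuadFam G m η) (hG : Dense (G : Set E)) (hC : η C ≠ ∞) (x y : E) :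
    bilOf G m C x y = bilOf G m C y x := by
  have hneg : ∀ z ∈ G, (m (-z) C).toReal = (m z C).toReal := fun z hz => by
    rw [← hQ.bilOf_self hG hC hz, ← hQ.bilOf_self hG hC (G.neg_mem hz)]
    simp
  have := hQ.bilOf_eq hG hC (B := (bilOf G m C).flip) fun x hx y hy => by
    rw [ContinuousLinearMap.flip_apply, hQ.bilOf_apply hG hC hy hx, ← neg_sub x y,
      hneg _ (G.sub_mem hx hy), add_comm]
  conv_lhs => rw [this]
  rfl

lemma QuadFam.bilOf_self_nonneg (hQ : QuadFam G m η) (hG : Dense (G : Set E)) (hC : η C ≠ ∞)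
    (x : E) : 0 ≤ bilOf G m C x x := by
  refine isClosed_property (p := fun x => 0 ≤ bilOf G m C x x) hG.denseRange_val
    (isClosed_le (by fun_prop) (by fun_prop)) (fun a => ?_) x
  rw [hQ.bilOf_self hG hC a.2]
  exact ENNReal.toReal_nonneg

/-- A bounded form is determined by its values on a dense subgroup. This allows any vector to be
adjoined to G afterwards without changing the form. -/
lemma QuadFam.bilOf_congr (hQ : QuadFam G m η) (hQ' : QuadFam H m η) (hG : Dense (G : Set E))
    (hGH : G ≤ H) (hC : η C ≠ ∞) : bilOf G m C = bilOf H m C :=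
  hQ.bilOf_eq hG hC fun _ hx _ hy =>
    hQ'.bilOf_apply (hG.mono hGH) hC (hGH hx) (hGH hy)

lemma QuadFam.bilOf_empty (hQ : QuadFam G m η) (hG : Dense (G : Set E)) : bilOf G m ∅ = 0 :=
  hQ.bilOf_eq hG (by simp) fun x _ y _ => by simp

/-- The bilinear forms are countably additive in norm. -/
lemma QuadFam.hasSum_bilOf (hQ : QuadFam G m η) (hG : Dense (G : Set E)) {D : ℕ → Set S}
    (hD : ∀ i, MeasurableSet (D i)) (hdisj : Pairwise (Function.onFun Disjoint D))
    (hη : η (⋃ i, D i) ≠ ∞) :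
    HasSum (fun i => bilOf G m (D i)) (bilOf G m (⋃ i, D i)) := by
  have hDη : ∀ i, η (D i) ≠ ∞ := fun i => ne_top_of_le_ne_top hη (measure_mono (subset_iUnion D i))
  -- The norms are bounded by η (D i), whose sum is η of the union; the limit is then identified on
  -- the dense subgroup.
  have hsum : Summable fun i => bilOf G m (D i) := by
    refine Summable.of_norm_bounded (g := fun i => (η (D i)).toReal) ?_
      fun i => hQ.norm_bilOf_le hG (hDη i)
    refine ENNReal.summable_toReal ?_
    rwa [← measure_iUnion hdisj hD]
  have hm : ∀ x ∈ G, HasSum (fun i => (m x (D i)).toReal) (m x (⋃ i, D i)).toReal := fun x hx => by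
    have hne := hQ.ne_top hη hx
    rw [measure_iUnion hdisj hD] at hne ⊢
    rw [ENNReal.tsum_toReal_eq fun i => hQ.ne_top (hDη i) hx]
    exact (ENNReal.summable_toReal hne).hasSum
  convert hsum.hasSum using 1
  refine hQ.bilOf_eq hG hη fun x hx y hy => ?_
  have h1 : HasSum (fun i => bilOf G m (D i) x y) ((∑' i, bilOf G m (D i)) x y) :=
    ((ContinuousLinearMap.apply ℝ ℝ y).comp (ContinuousLinearMap.apply ℝ (E →L[ℝ] ℝ) x)).hasSum
      hsum.hasSum
  have h2 := ((hm _ (G.add_mem hx hy)).sub (hm _ (G.sub_mem hx hy))).div_const 4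
  rw [funext fun i => hQ.bilOf_apply hG (hDη i) hx hy] at h1
  exact h1.unique h2

/-- The measures extend, as a quadratic form, from a dense subgroup to the whole space. -/
lemma QuadFam.exists_extension (hQ : QuadFam G m η) (hG : Dense (G : Set E)) {F : ℕ → Set S}
    (hF : ∀ k, MeasurableSet (F k)) (hdisj : Pairwise (Function.onFun Disjoint F))
    (hFU : (⋃ k, F k) = univ) (hFη : ∀ k, η (F k) ≠ ∞) :
    ∃ m' : E → Measure S, ∀ x C, MeasurableSet C → η C ≠ ∞ →
      m' x C = ENNReal.ofReal (bilOf G m C x x) := by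
  have hsum : ∀ (x : E) (D : ℕ → Set S), (∀ i, MeasurableSet (D i)) →
      Pairwise (Function.onFun Disjoint D) → η (⋃ i, D i) ≠ ∞ →
      ENNReal.ofReal (bilOf G m (⋃ i, D i) x x) =
        ∑' i, ENNReal.ofReal (bilOf G m (D i) x x) := by
    intro x D hD hdD hη
    have h1 : HasSum (fun i => bilOf G m (D i) x x) (bilOf G m (⋃ i, D i) x x) :=
      ((ContinuousLinearMap.apply ℝ ℝ x).comp
        (ContinuousLinearMap.apply ℝ (E →L[ℝ] ℝ) x)).hasSum (hQ.hasSum_bilOf hG hD hdD hη)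
    rw [← h1.tsum_eq, ENNReal.ofReal_tsum_of_nonneg (fun i => hQ.bilOf_self_nonneg hG
      (ne_top_of_le_ne_top hη (measure_mono (subset_iUnion D i))) x) h1.summable]
  -- Additivity of the forms is available only where η is finite, so the measure is built on each
  -- piece F k and then summed.
  let μ : ℕ → E → Measure S := fun k x => Measure.ofMeasurable
    (fun C _ => ENNReal.ofReal (bilOf G m (C ∩ F k) x x))
    (by simp [hQ.bilOf_empty hG])
    (fun D hD hdD => by
      rw [iUnion_inter]
      refine hsum x _ (fun i => (hD i).inter (hF k)) (fun i j hij => ?_) ?_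
      · exact (hdD hij).mono inter_subset_left inter_subset_left
      · rw [← iUnion_inter]
        exact ne_top_of_le_ne_top (hFη k) (measure_mono inter_subset_right))
  refine ⟨fun x => Measure.sum fun k => μ k x, fun x C hC hCη => ?_⟩
  have hCF : C = ⋃ k, C ∩ F k := by rw [← inter_iUnion, hFU, inter_univ]
  rw [Measure.sum_apply _ hC]
  simp only [μ, Measure.ofMeasurable_apply _ hC]
  conv_rhs => rw [hCF]
  refine (hsum x _ (fun k => hC.inter (hF k)) (fun i j hij => ?_) (by rwa [← hCF])).symm
  exact (hdisj hij).mono inter_subset_right inter_subset_right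

/-- Measures that agree on the sets where `η` is finite agree, if `η` is `σ`-finite. -/
lemma measure_ext_of_ne_top {μ₁ μ₂ : Measure S} {F : ℕ → Set S}
    (hF : ∀ k, MeasurableSet (F k)) (hdisj : Pairwise (Function.onFun Disjoint F))
    (hFU : (⋃ k, F k) = univ) (hFη : ∀ k, η (F k) ≠ ∞)
    (h : ∀ C, MeasurableSet C → η C ≠ ∞ → μ₁ C = μ₂ C) : μ₁ = μ₂ := by
  ext C hC
  have hCF : C = ⋃ k, C ∩ F k := by rw [← inter_iUnion, hFU, inter_univ]
  have hd : Pairwise (Function.onFun Disjoint fun k => C ∩ F k) := fun i j hij =>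
    (hdisj hij).mono inter_subset_right inter_subset_right
  rw [hCF, measure_iUnion hd fun k => hC.inter (hF k),
    measure_iUnion hd fun k => hC.inter (hF k)]
  exact tsum_congr fun k => h _ (hC.inter (hF k))
    (ne_top_of_le_ne_top (hFη k) (measure_mono inter_subset_right))

/-- The forms from G and H coincide, and on H the diagonal of the form is the original measure; so
the extension built from G alone recovers m x for x outside G. -/
lemma QuadFam.extension_eq (hQ : QuadFam G m η) (hQ' : QuadFam H m η) (hG : Dense (G : Set E))
    (hGH : G ≤ H) {F : ℕ → Set S}
    (hF : ∀ k, MeasurableSet (F k)) (hdisj : Pairwise (Function.onFun Disjoint F))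
    (hFU : (⋃ k, F k) = univ) (hFη : ∀ k, η (F k) ≠ ∞) {x : E} (hx : x ∈ H) {μ : Measure S}
    (hμ : ∀ C, MeasurableSet C → η C ≠ ∞ → μ C = ENNReal.ofReal (bilOf G m C x x)) :
    μ = m x :=
  measure_ext_of_ne_top hF hdisj hFU hFη fun C hC hCη => by
    rw [hμ C hC hCη, hQ.bilOf_congr hQ' hG hGH hCη, hQ'.bilOf_self (hG.mono hGH) hCη hx,
      ENNReal.ofReal_toReal (hQ'.ne_top hCη hx)]

lemma QuadFam.polarization (hQ : QuadFam G m η) (hG : Dense (G : Set E)) (hC : η C ≠ ∞)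
    {m' : E → Measure S} (hm' : ∀ x, m' x C = ENNReal.ofReal (bilOf G m C x x)) (x y : E) :
    ((m' (x + y) C).toReal - (m' (x - y) C).toReal) / 4 = bilOf G m C x y := by
  rw [hm', hm', ENNReal.toReal_ofReal (hQ.bilOf_self_nonneg hG hC _),
    ENNReal.toReal_ofReal (hQ.bilOf_self_nonneg hG hC _)]
  simp only [map_add, map_sub, add_apply, sub_apply]
  rw [hQ.bilOf_symm hG hC y x]
  ring

end QuadFam

end CylMVM

/-! ### Almost sure quadratic structure of the intensity measures. -/

namespace CylMVM

lemma IsLusin.countablyGenerated {U : Type*} [TopologicalSpace U] [MeasurableSpace U]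
    [BorelSpace U] (hU : IsLusin U) : MeasurableSpace.CountablyGenerated U := by
  obtain ⟨S, -, ⟨e⟩⟩ := hU
  have : SecondCountableTopology U := e.secondCountableTopology
  infer_instance

section Intensity

variable {Ω U X : Type*} [mΩ : MeasurableSpace Ω] [MeasurableSpace U]
  [NormedAddCommGroup X] [NormedSpace ℝ X] {P : Measure Ω}
  {𝓕 : Filtration ℝ≥0 mΩ} {𝒜 : Set (Set U)} {M : ℝ≥0 → Set U → StrongDual ℝ X → Ω → ℝ}
  {ν : StrongDual ℝ X → Ω → Measure (ℝ≥0 × U)} {η : Ω → Measure (ℝ≥0 × U)} {A : Set U}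

lemma IsIntensity.exists_compensator {N : ℝ≥0 → Set U → Ω → ℝ} {ν : Ω → Measure (ℝ≥0 × U)}
    (h : IsIntensity P 𝓕 𝒜 N ν) (hA : A ∈ 𝒜) :
    ∃ V, IsCompensator P 𝓕 (fun t ω => N t A ω * N t A ω) V ∧
      ∀ t, ∀ᵐ ω ∂P, ν ω (Icc 0 t ×ˢ A) = ENNReal.ofReal (V t ω) ∧ 0 ≤ V t ω := by
  obtain ⟨V, hV, hVν⟩ := h.bracket A hA
  refine ⟨V, isQuadCov_iff_isCompensator.1 hV, fun t => ?_⟩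
  filter_upwards [hVν t] with ω hω
  rw [← hω.2, ENNReal.ofReal_toReal hω.1.ne]
  exact ⟨rfl, ENNReal.toReal_nonneg⟩

variable (hM : IsCylOrthMartMeasure P 𝓕 𝒜 M)
  (hν : ∀ x, IsIntensity P 𝓕 𝒜 (fun t A => M t A x) (ν x))
  (h𝓕 : ∀ N : Set Ω, P N = 0 → MeasurableSet[𝓕 0] N)

include hM in
lemma IsCylOrthMartMeasure.stronglyAdapted_mul (hA : A ∈ 𝒜) (x y : StrongDual ℝ X) :
    StronglyAdapted 𝓕 fun t ω => M t A x ω * M t A y ω := fun t =>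
  ((hM.martingale A hA x).martingale.1 t).mul ((hM.martingale A hA y).martingale.1 t)

include hM in
lemma IsCylOrthMartMeasure.ae_smul (hA : A ∈ 𝒜) (t : ℝ≥0) (c : ℝ) (x : StrongDual ℝ X) :
    ∀ᵐ ω ∂P, M t A (c • x) ω = c * M t A x ω := by
  filter_upwards [hM.linear t A hA c x 0, hM.linear t A hA 1 0 0] with ω h1 h2
  simp only [smul_zero, add_zero] at h1 h2
  linarith

include hM in
lemma IsCylOrthMartMeasure.ae_add (hA : A ∈ 𝒜) (t : ℝ≥0) (x y : StrongDual ℝ X) :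
    ∀ᵐ ω ∂P, M t A (x + y) ω = M t A x ω + M t A y ω := by
  filter_upwards [hM.linear t A hA 1 x y] with ω h1
  simpa using h1

include hM in
lemma IsCylOrthMartMeasure.ae_sub (hA : A ∈ 𝒜) (t : ℝ≥0) (x y : StrongDual ℝ X) :
    ∀ᵐ ω ∂P, M t A (x - y) ω = M t A x ω - M t A y ω := by
  filter_upwards [hM.linear t A hA (-1) y x] with ω h1
  rw [show x - y = (-1 : ℝ) • y + x by rw [neg_one_smul, neg_add_eq_sub], h1]
  ring

include hM in
lemma IsCylOrthMartMeasure.exists_exhaustion : ∃ E : ℕ → Set U, Monotone E ∧ (⋃ n, E n) = univ ∧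
    (∀ n, MeasurableSet (E n)) ∧ ∀ n, ∀ B, MeasurableSet B → B ⊆ E n → B ∈ 𝒜 := by
  obtain ⟨E, h1, h2, h3, h4, -⟩ := (hM.measure 1 one_pos 0).sigmaFinite
  exact ⟨E, h1, h2, h3, h4⟩

include hM hν in
/-- Polarization of the predictable quadratic variation. -/
lemma exists_quadCov (hA : A ∈ 𝒜) (x y : StrongDual ℝ X) :
    ∃ V, IsQuadCov P 𝓕 (fun t => M t A x) (fun t => M t A y) V ∧
      ∀ t, ∀ᵐ ω ∂P, ν (x + y) ω (Icc 0 t ×ˢ A) ≠ ∞ ∧ ν (x - y) ω (Icc 0 t ×ˢ A) ≠ ∞ ∧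
        alpha (fun z => ν z ω) (Icc 0 t ×ˢ A) x y = V t ω := by
  obtain ⟨V₁, h₁, e₁⟩ := (hν (x + y)).exists_compensator hA
  obtain ⟨V₂, h₂, e₂⟩ := (hν (x - y)).exists_compensator hA
  refine ⟨_, isQuadCov_iff_isCompensator.2 (((h₁.const_mul (1 / 4)).add
    (h₂.const_mul (-1 / 4))).congr (hM.stronglyAdapted_mul hA x y) fun t => ?_), fun t => ?_⟩
  · filter_upwards [hM.ae_add hA t x y, hM.ae_sub hA t x y] with ω hω hω'
    rw [hω, hω']
    ring
  · filter_upwards [e₁ t, e₂ t] with ω f₁ f₂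
    rw [alpha, f₁.1, f₂.1, ENNReal.toReal_ofReal f₁.2, ENNReal.toReal_ofReal f₂.2]
    refine ⟨by simp, by simp, by ring⟩

variable [IsProbabilityMeasure P]

include hM hν h𝓕 in
-- Both sides compensate the same process, since (a + b)² + (a - b)² = 2a² + 2b² for a = M(A)(x) and
-- b = M(A)(y); compensators are unique.
lemma ae_parallelogram_rect (hA : A ∈ 𝒜) (x y : StrongDual ℝ X) (t : ℝ≥0) :
    ∀ᵐ ω ∂P, (ν (x + y) ω + ν (x - y) ω) (Icc 0 t ×ˢ A) ≠ ∞ ∧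
      (ν (x + y) ω + ν (x - y) ω) (Icc 0 t ×ˢ A) =
        ((2 : ℝ≥0∞) • ν x ω + (2 : ℝ≥0∞) • ν y ω) (Icc 0 t ×ˢ A) := by
  obtain ⟨V₁, h₁, e₁⟩ := (hν (x + y)).exists_compensator hA
  obtain ⟨V₂, h₂, e₂⟩ := (hν (x - y)).exists_compensator hA
  obtain ⟨V₃, h₃, e₃⟩ := (hν x).exists_compensator hA
  obtain ⟨V₄, h₄, e₄⟩ := (hν y).exists_compensator hA
  have h := ((h₃.const_mul 2).add (h₄.const_mul 2)).congr
    (R' := fun t ω => M t A (x + y) ω * M t A (x + y) ω + M t A (x - y) ω * M t A (x - y) ω)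
    (fun t => (hM.stronglyAdapted_mul hA (x + y) (x + y) t).add
      (hM.stronglyAdapted_mul hA (x - y) (x - y) t)) fun t => by
    filter_upwards [hM.ae_add hA t x y, hM.ae_sub hA t x y] with ω hω hω'
    rw [hω, hω']
    ring
  filter_upwards [(h₁.add h₂).unique h𝓕 h t, e₁ t, e₂ t, e₃ t, e₄ t] with ω hω f₁ f₂ f₃ f₄
  simp only [Measure.add_apply, Measure.smul_apply, smul_eq_mul, f₁.1, f₂.1, f₃.1, f₄.1]
  refine ⟨by simp, ?_⟩
  rw [← ENNReal.ofReal_add f₁.2 f₂.2, hω, ENNReal.ofReal_add (by linarith [f₃.2])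
    (by linarith [f₄.2]), ENNReal.ofReal_mul two_pos.le, ENNReal.ofReal_mul two_pos.le]
  simp

include hM hν h𝓕 in
lemma ae_smul_rect (hA : A ∈ 𝒜) (c : ℝ) (x : StrongDual ℝ X) (t : ℝ≥0) :
    ∀ᵐ ω ∂P, ν (c • x) ω (Icc 0 t ×ˢ A) ≠ ∞ ∧
      ν (c • x) ω (Icc 0 t ×ˢ A) = (ENNReal.ofReal (c ^ 2) • ν x ω) (Icc 0 t ×ˢ A) := by
  obtain ⟨V₁, h₁, e₁⟩ := (hν (c • x)).exists_compensator hA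
  obtain ⟨V₂, h₂, e₂⟩ := (hν x).exists_compensator hA
  have h := (h₂.const_mul (c ^ 2)).congr (R' := fun t ω => M t A (c • x) ω * M t A (c • x) ω)
    (hM.stronglyAdapted_mul hA _ _) fun t => by
    filter_upwards [hM.ae_smul hA t c x] with ω hω
    rw [hω]
    ring
  filter_upwards [h₁.unique h𝓕 h t, e₁ t, e₂ t] with ω hω f₁ f₂
  simp only [Measure.smul_apply, smul_eq_mul, f₁.1, f₂.1]
  refine ⟨by simp, ?_⟩
  rw [hω, ENNReal.ofReal_mul (by positivity)]

variable [MeasurableSpace.CountablyGenerated U]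

include hM hν h𝓕 in
lemma ae_parallelogram (x y : StrongDual ℝ X) :
    ∀ᵐ ω ∂P, ν (x + y) ω + ν (x - y) ω = (2 : ℝ≥0∞) • ν x ω + (2 : ℝ≥0∞) • ν y ω := by
  obtain ⟨E, h1, h2, h3, h4⟩ := hM.exists_exhaustion
  exact ae_measure_eq_of_rect h2 h1 h3 fun n B hB hBE t =>
    ae_parallelogram_rect hM hν h𝓕 (h4 n B hB hBE) x y t

include hM hν h𝓕 in
lemma ae_smul_measure (c : ℝ) (x : StrongDual ℝ X) :
    ∀ᵐ ω ∂P, ν (c • x) ω = ENNReal.ofReal (c ^ 2) • ν x ω := by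
  obtain ⟨E, h1, h2, h3, h4⟩ := hM.exists_exhaustion
  exact ae_measure_eq_of_rect h2 h1 h3 fun n B hB hBE t =>
    ae_smul_rect hM hν h𝓕 (h4 n B hB hBE) c x t

include hM hν h𝓕 in
-- Domination is assumed only on the unit sphere; quadratic scaling carries it to x = ‖x‖ • (‖x‖⁻¹ •
-- x). The zero vector has no normalization, but its intensity vanishes.
lemma ae_le_smul_quadVar (hη : IsQuadVar P 𝒜 ν η) (x : StrongDual ℝ X) :
    ∀ᵐ ω ∂P, ν x ω ≤ ENNReal.ofReal (‖x‖ ^ 2) • η ω := by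
  rcases eq_or_ne x 0 with rfl | hx
  · filter_upwards [ae_smul_measure hM hν h𝓕 0 0] with ω hω
    rw [smul_zero] at hω
    rw [hω]
    simp
  · have hx' : ‖x‖ ≠ 0 := norm_ne_zero_iff.2 hx
    have h1 : ‖‖x‖⁻¹ • x‖ = 1 := by rw [norm_smul, norm_inv, norm_norm, inv_mul_cancel₀ hx']
    filter_upwards [ae_smul_measure hM hν h𝓕 ‖x‖ (‖x‖⁻¹ • x), hη.upper _ h1] with ω hω hω'
    rw [smul_inv_smul₀ hx'] at hω
    rw [hω]
    exact Measure.le_iff'.2 fun s => mul_le_mul_right (hω' s) _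

include hM hν h𝓕 in
/-- Almost surely, the intensity measures form a quadratic form on a given countable subgroup. -/
lemma ae_quadFam (hη : IsQuadVar P 𝒜 ν η) (G : AddSubgroup (StrongDual ℝ X))
    (hG : (G : Set (StrongDual ℝ X)).Countable) :
    ∀ᵐ ω ∂P, QuadFam G (fun x => ν x ω) (η ω) := by
  have h1 : ∀ᵐ ω ∂P, ∀ x ∈ (G : Set (StrongDual ℝ X)), ∀ y ∈ (G : Set (StrongDual ℝ X)),
      ν (x + y) ω + ν (x - y) ω = (2 : ℝ≥0∞) • ν x ω + (2 : ℝ≥0∞) • ν y ω := by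
    rw [ae_ball_iff hG]
    intro x hx
    rw [ae_ball_iff hG]
    exact fun y hy => ae_parallelogram hM hν h𝓕 x y
  have h2 : ∀ᵐ ω ∂P, ∀ x ∈ (G : Set (StrongDual ℝ X)), ν x ω ≤ ENNReal.ofReal (‖x‖ ^ 2) • η ω := by
    rw [ae_ball_iff hG]
    exact fun x hx => ae_le_smul_quadVar hM hν h𝓕 hη x
  filter_upwards [h1, h2] with ω h1 h2
  exact ⟨h1, h2⟩

end Intensity

end CylMVM

/-! ### Predictability of modifications and construction of the versions. -/

namespace CylMVM

/-- Elements of the closure are integer combinations of s. Countability is the reason for working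
with subgroups rather than real subspaces. -/
lemma countable_addSubgroup_closure {E : Type*} [AddCommGroup E] {s : Set E} (hs : s.Countable) :
    (AddSubgroup.closure s : Set E).Countable := by
  have : Countable s := hs
  rw [← Submodule.span_int_eq_addSubgroupClosure, Submodule.coe_toAddSubgroup]
  have h := Finsupp.range_linearCombination ℤ (v := ((↑) : s → E))
  rw [Subtype.range_coe] at h
  rw [← h, LinearMap.coe_range]
  exact countable_range _

section Predictable

variable {Ω : Type*} [mΩ : MeasurableSpace Ω] {P : Measure Ω} {𝓕 : Filtration ℝ≥0 mΩ}

lemma measurable_fst_predictable (𝓕 : Filtration ℝ≥0 mΩ) :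
    Measurable[𝓕.predictable] (Prod.fst : ℝ≥0 × Ω → ℝ≥0) := by
  refine measurable_of_Ioi fun a => ?_
  rw [← prod_univ]
  exact measurableSet_predictable_Ioi_prod MeasurableSet.univ

lemma measurable_snd_predictable {f : Ω → ℝ≥0} (hf : Measurable[𝓕 0] f) :
    Measurable[𝓕.predictable] (fun p : ℝ≥0 × Ω => f p.2) := fun s hs => by
  have := measurableSet_predictable_univ_prod (hf hs)
  rwa [univ_prod] at this

/-- A process that is predictable off a null set and monotone is predictable. -/
lemma isStronglyPredictable_of_ae_eq (h𝓕 : ∀ N : Set Ω, P N = 0 → MeasurableSet[𝓕 0] N)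
    {φ ψ : ℝ≥0 → Ω → ℝ≥0∞} (hψ : IsStronglyPredictable 𝓕 ψ) (hφ : ∀ ω, Monotone fun t => φ t ω)
    (h : ∀ᵐ ω ∂P, ∀ t, φ t ω = ψ t ω) : IsStronglyPredictable 𝓕 φ := by
  classical
  let N : Set Ω := {ω | ∀ t, φ t ω = ψ t ω}ᶜ
  have hN : ∀ s, MeasurableSet[𝓕 0] (s ∩ N) := fun s =>
    h𝓕 _ (measure_mono_null inter_subset_right h)
  refine Measurable.stronglyMeasurable (mα := 𝓕.predictable)
    (measurable_of_Ioi fun a => ?_)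
  -- On the null set N every random variable is 𝓕 0-measurable. By monotonicity {t | a < φ t ω} is
  -- empty, (τ, ∞) or [τ, ∞), so τ and two subsets of N describe it.
  let τ : Ω → ℝ≥0 := fun ω => if ω ∈ N then sInf {t | a < φ t ω} else 0
  have hτ : Measurable[𝓕 0] τ := fun s _ => by
    have : τ ⁻¹' s = τ ⁻¹' s ∩ N ∪ {ω | (0 : ℝ≥0) ∈ s} ∩ Nᶜ := by
      ext ω
      by_cases hω : ω ∈ N <;> simp [hω, τ]
    rw [this]
    refine (hN _).union (MeasurableSet.inter (.const _) ?_)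
    simpa using (hN univ).compl
  have h1 := measurable_fst_predictable 𝓕
  have h2 := measurable_snd_predictable hτ
  have key : Function.uncurry φ ⁻¹' Ioi a =
      ({p | τ p.2 < p.1} ∩ (univ : Set ℝ≥0) ×ˢ ({ω | ∃ t, a < φ t ω} ∩ N) ∪
        {p | p.1 = τ p.2} ∩ (univ : Set ℝ≥0) ×ˢ ({ω | a < φ (τ ω) ω} ∩ N)) ∪
      Function.uncurry ψ ⁻¹' Ioi a ∩ (univ : Set ℝ≥0) ×ˢ (univ ∩ N)ᶜ := by
    ext ⟨t, ω⟩
    by_cases hω : ω ∈ N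
    · have hτω : τ ω = sInf {t | a < φ t ω} := by simp [τ, hω]
      simp only [mem_preimage, Function.uncurry_apply_pair, mem_Ioi, mem_union, mem_inter_iff,
        mem_ofPred_eq, mem_prod, mem_univ, true_and, hω, and_true, mem_compl_iff, not_true,
        and_false, or_false]
      constructor
      · intro ht
        rcases (hτω ▸ csInf_le' ht : τ ω ≤ t).lt_or_eq with h | h
        · exact .inl ⟨h, t, ht⟩
        · exact .inr ⟨h.symm, h ▸ ht⟩
      · rintro (⟨h, s, hs⟩ | ⟨h, h'⟩)
        · obtain ⟨r, hr, hrt⟩ := exists_lt_of_csInf_lt ⟨s, hs⟩ (hτω ▸ h)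
          exact lt_of_lt_of_le hr (hφ ω hrt.le)
        · exact h ▸ h'
    · have : φ t ω = ψ t ω := not_not.1 hω t
      simp [hω, this]
  rw [key]
  refine .union (.union (.inter ?_ ?_) (.inter ?_ ?_)) (.inter ?_ ?_)
  · exact measurableSet_lt h2 h1
  · exact measurableSet_predictable_univ_prod (hN _)
  · exact measurableSet_eq_fun h1 h2
  · exact measurableSet_predictable_univ_prod (hN _)
  · exact hψ.measurable measurableSet_Ioi
  · exact measurableSet_predictable_univ_prod (hN _).compl

/-- A version of the intensity measure. -/
lemma IsIntensity.congr {U : Type*} [MeasurableSpace U] [P.IsComplete]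
    (h𝓕 : ∀ N : Set Ω, P N = 0 → MeasurableSet[𝓕 0] N) {𝒜 : Set (Set U)}
    {N : ℝ≥0 → Set U → Ω → ℝ} {ν ν' : Ω → Measure (ℝ≥0 × U)}
    (h : IsIntensity P 𝓕 𝒜 N ν) (hν' : ∀ᵐ ω ∂P, ν' ω = ν ω) : IsIntensity P 𝓕 𝒜 N ν' where
  measurable := h.measurable.congr_ae (hν'.mono fun _ h => h.symm)
  sigmaFinite := by
    filter_upwards [h.sigmaFinite, hν'] with ω h1 h2
    rwa [h2]
  predictable A hA := isStronglyPredictable_of_ae_eq h𝓕 (h.predictable A hA)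
    (fun ω _ _ hst => measure_mono (prod_mono (Icc_subset_Icc_right hst) subset_rfl))
    (by filter_upwards [hν'] with ω h2 t using by rw [h2])
  bracket A hA := by
    obtain ⟨V, hV, hVν⟩ := h.bracket A hA
    refine ⟨V, hV, fun t => ?_⟩
    filter_upwards [hVν t, hν'] with ω h1 h2
    rwa [h2]

end Predictable

section Versions

variable {Ω U X : Type*} [mΩ : MeasurableSpace Ω] [MeasurableSpace U]
  [NormedAddCommGroup X] [NormedSpace ℝ X] {P : Measure Ω} [IsProbabilityMeasure P]
  {𝓕 : Filtration ℝ≥0 mΩ} {𝒜 : Set (Set U)} {M : ℝ≥0 → Set U → StrongDual ℝ X → Ω → ℝ}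
  {ν : StrongDual ℝ X → Ω → Measure (ℝ≥0 × U)} {η : Ω → Measure (ℝ≥0 × U)}

/-- Versions of the intensity measures that form a quadratic form for almost every `ω`. -/
lemma exists_versions [MeasurableSpace.CountablyGenerated U]
    [TopologicalSpace.SeparableSpace (StrongDual ℝ X)]
    (hM : IsCylOrthMartMeasure P 𝓕 𝒜 M)
    (hν : ∀ x, IsIntensity P 𝓕 𝒜 (fun t A => M t A x) (ν x))
    (h𝓕 : ∀ N : Set Ω, P N = 0 → MeasurableSet[𝓕 0] N) (hη : IsQuadVar P 𝒜 ν η) :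
    ∃ G : AddSubgroup (StrongDual ℝ X), Dense (G : Set (StrongDual ℝ X)) ∧
      ∃ ν' : StrongDual ℝ X → Ω → Measure (ℝ≥0 × U), (∀ x, ∀ᵐ ω ∂P, ν' x ω = ν x ω) ∧
        ∀ᵐ ω ∂P, QuadFam G (fun x => ν x ω) (η ω) ∧ ∀ x C, MeasurableSet C → η ω C ≠ ∞ →
          ν' x ω C = ENNReal.ofReal (bilOf G (fun x => ν x ω) C x x) := by
  classical
  let s : Set (StrongDual ℝ X) := range (TopologicalSpace.denseSeq (StrongDual ℝ X))
  have hs : s.Countable := countable_range _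
  let G := AddSubgroup.closure s
  have hG : Dense (G : Set (StrongDual ℝ X)) :=
    (TopologicalSpace.denseRange_denseSeq _).mono AddSubgroup.subset_closure
  obtain ⟨E, hEm, hEU, hE, hE𝒜⟩ := hM.exists_exhaustion
  let K : ℕ → Set (ℝ≥0 × U) := fun n => Icc 0 (n : ℝ≥0) ×ˢ E n
  have hK : ∀ n, MeasurableSet (K n) := fun n => measurableSet_Icc.prod (hE n)
  let F : ℕ → Set (ℝ≥0 × U) := disjointed K
  have hF : ∀ n, MeasurableSet (F n) := MeasurableSet.disjointed hK
  have hdisj : Pairwise (Function.onFun Disjoint F) := disjoint_disjointed K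
  have hFU : (⋃ n, F n) = univ := by
    rw [iUnion_disjointed]
    refine eq_univ_of_forall fun ⟨t, u⟩ => ?_
    obtain ⟨n, hn⟩ := mem_iUnion.1 (hEU ▸ mem_univ u : u ∈ ⋃ n, E n)
    obtain ⟨k, hk⟩ := exists_nat_ge t
    refine mem_iUnion.2 ⟨max n k, ⟨zero_le, hk.trans ?_⟩, hEm (le_max_left n k) hn⟩
    exact_mod_cast le_max_right n k
  have hFη : ∀ᵐ ω ∂P, ∀ n, η ω (F n) ≠ ∞ := by
    rw [ae_all_iff]
    intro n
    filter_upwards [hη.finite n (E n) (hE𝒜 n _ (hE n) subset_rfl)] with ω hω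
    exact ne_top_of_le_ne_top hω.ne (measure_mono (disjointed_subset K n))
  let good : Ω → Prop := fun ω => ∃ m' : StrongDual ℝ X → Measure (ℝ≥0 × U), ∀ x C,
    MeasurableSet C → η ω C ≠ ∞ → m' x C = ENNReal.ofReal (bilOf G (fun x => ν x ω) C x x)
  -- The extension is chosen once per ω, simultaneously for all x; on the remaining null set the
  -- value 0 is harmless.
  let ν' : StrongDual ℝ X → Ω → Measure (ℝ≥0 × U) := fun x ω =>
    if h : good ω then h.choose x else 0
  have hν'G : ∀ᵐ ω ∂P, QuadFam G (fun x => ν x ω) (η ω) ∧ ∀ x C, MeasurableSet C → η ω C ≠ ∞ →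
      ν' x ω C = ENNReal.ofReal (bilOf G (fun x => ν x ω) C x x) := by
    filter_upwards [hFη, ae_quadFam hM hν h𝓕 hη G (countable_addSubgroup_closure hs)]
      with ω h1 hQ
    have h : good ω := hQ.exists_extension hG hF hdisj hFU h1
    refine ⟨hQ, fun x C hC hCη => ?_⟩
    simp only [ν', dif_pos h]
    exact h.choose_spec x C hC hCη
  refine ⟨G, hG, ν', fun x => ?_, hν'G⟩
  -- Adjoining x keeps the group countable, so the quadratic structure holds on H off a null set
  -- depending on x, and there the new measure equals ν x ω.
  let H := AddSubgroup.closure (insert x s)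
  filter_upwards [hFη, hν'G,
    ae_quadFam hM hν h𝓕 hη H (countable_addSubgroup_closure (hs.insert x))] with ω h1 h2 h3
  exact h2.1.extension_eq h3 hG (AddSubgroup.closure_mono (subset_insert x s)) hF hdisj hFU h1
    (AddSubgroup.subset_closure (mem_insert x s)) (h2.2 x)

end Versions

end CylMVM

/-! ### Vector measures on [0, T] × U and the conclusion. -/

namespace CylMVM

section OnIcc

variable {U : Type*} [MeasurableSpace U] {T : ℝ≥0}

/-- A subset of `[0, T] × U`, seen as a subset of `ℝ₊ × U`. -/
def ofIcc (D : Set (Icc (0 : ℝ≥0) T × U)) : Set (ℝ≥0 × U) :=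
  Prod.map Subtype.val id '' D

omit [MeasurableSpace U] in
lemma injective_ofIcc : Function.Injective (Prod.map Subtype.val id : Icc (0 : ℝ≥0) T × U → _) :=
  Subtype.val_injective.prodMap Function.injective_id

lemma measurableSet_ofIcc {D : Set (Icc (0 : ℝ≥0) T × U)} (hD : MeasurableSet D) :
    MeasurableSet (ofIcc D) :=
  ((MeasurableEmbedding.subtype_coe measurableSet_Icc).prodMap .id).measurableSet_image.2 hD

omit [MeasurableSpace U] in
lemma ofIcc_subset (D : Set (Icc (0 : ℝ≥0) T × U)) : ofIcc D ⊆ Icc 0 T ×ˢ univ := by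
  rintro _ ⟨p, -, rfl⟩
  exact ⟨p.1.2, mem_univ _⟩

omit [MeasurableSpace U] in
lemma ofIcc_onIcc {C : Set (ℝ≥0 × U)} (hC : C ⊆ Icc 0 T ×ˢ univ) : ofIcc (onIcc T C) = C := by
  ext ⟨t, u⟩
  constructor
  · rintro ⟨p, hp, h⟩
    rw [← h]
    exact hp
  · exact fun h => ⟨(⟨t, (hC h).1⟩, u), h, rfl⟩

lemma measurableSet_onIcc {C : Set (ℝ≥0 × U)} (hC : MeasurableSet C) :
    MeasurableSet (onIcc T C) :=
  (measurable_subtype_coe.prodMap measurable_id) hC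

variable {X : Type*} [NormedAddCommGroup X] [NormedSpace ℝ X]
  {G : AddSubgroup (StrongDual ℝ X)} {m : StrongDual ℝ X → Measure (ℝ≥0 × U)}
  {η : Measure (ℝ≥0 × U)}

/-- The bilinear forms, as a vector measure on `[0, T] × U`. -/
lemma QuadFam.exists_vectorMeasure (hQ : QuadFam G m η) (hG : Dense (G : Set (StrongDual ℝ X)))
    (hη : η (Icc 0 T ×ˢ univ) ≠ ∞) :
    ∃ α : VectorMeasure (Icc (0 : ℝ≥0) T × U) (Bil X), ∀ D, MeasurableSet D →
      α D = bilOf G m (ofIcc D) := by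
  classical
  refine ⟨⟨fun D => if MeasurableSet D then bilOf G m (ofIcc D) else 0, ?_, ?_, ?_⟩,
    fun D hD => if_pos hD⟩
  · rw [if_pos .empty, ofIcc, image_empty, hQ.bilOf_empty hG]
  · exact fun D hD => if_neg hD
  · intro D hD hdisj
    simp only [hD, MeasurableSet.iUnion hD, if_true]
    rw [ofIcc, image_iUnion]
    refine hQ.hasSum_bilOf hG (fun i => measurableSet_ofIcc (hD i)) (fun i j hij => ?_) ?_
    · exact (disjoint_image_iff injective_ofIcc).2 (hdisj hij)
    · refine ne_top_of_le_ne_top hη (measure_mono (iUnion_subset fun i => ofIcc_subset (D i)))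

end OnIcc

section Versions

variable {Ω U X : Type*} [mΩ : MeasurableSpace Ω] [MeasurableSpace U]
  [NormedAddCommGroup X] [NormedSpace ℝ X] {P : Measure Ω}
  {G : AddSubgroup (StrongDual ℝ X)}
  {ν ν' : StrongDual ℝ X → Ω → Measure (ℝ≥0 × U)} {η : Ω → Measure (ℝ≥0 × U)}

/-- The ring need not contain the whole space, but it contains an increasing exhaustion, so
continuity from below applies. -/
lemma Icc_prod_ne_top_of_iSup {𝒜 : Set (Set U)} {E : ℕ → Set U} (hEm : Monotone E)
    (hEU : (⋃ n, E n) = univ) (hE : ∀ n, E n ∈ 𝒜) {η : Measure (ℝ≥0 × U)} {T : ℝ≥0}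
    (h : (⨆ A ∈ 𝒜, η (Icc 0 T ×ˢ A)) < ∞) : η (Icc 0 T ×ˢ univ) ≠ ∞ := by
  rw [← hEU, prod_iUnion, Monotone.measure_iUnion fun i j hij => prod_mono subset_rfl (hEm hij)]
  exact ne_top_of_le_ne_top h.ne (iSup_le fun n => le_iSup₂_of_le (E n) (hE n) le_rfl)

lemma bilOf_eq_alpha {m m' : StrongDual ℝ X → Measure (ℝ≥0 × U)} {η : Measure (ℝ≥0 × U)}
    (hQ : QuadFam G m η) (hG : Dense (G : Set (StrongDual ℝ X))) {C : Set (ℝ≥0 × U)}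
    (hC : η C ≠ ∞) (hm' : ∀ x, m' x C = ENNReal.ofReal (bilOf G m C x x)) (x y : StrongDual ℝ X) :
    bilOf G m C x y = alpha m' C x y :=
  (hQ.polarization hG hC hm' x y).symm

/-- The random vector measure that extends `alpha`. -/
lemma exists_random_vectorMeasure [P.IsComplete] (hG : Dense (G : Set (StrongDual ℝ X)))
    (hν : ∀ x, Measurable (ν' x)) {T : ℝ≥0}
    (hη : ∀ᵐ ω ∂P, η ω (Icc 0 T ×ˢ univ) ≠ ∞)
    (h : ∀ᵐ ω ∂P, QuadFam G (fun x => ν x ω) (η ω) ∧ ∀ x C, MeasurableSet C → η ω C ≠ ∞ →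
      ν' x ω C = ENNReal.ofReal (bilOf G (fun x => ν x ω) C x x)) :
    ∃ α : Ω → VectorMeasure (Icc (0 : ℝ≥0) T × U) (Bil X),
      (∀ C, MeasurableSet C → ∀ x y, Measurable fun ω => α ω C x y) ∧
      ∀ᵐ ω ∂P, (∀ x, ν' x ω (Icc 0 T ×ˢ univ) < ∞) ∧
        ∀ C : Set (ℝ≥0 × U), MeasurableSet C → C ⊆ Icc 0 T ×ˢ univ →
          ∀ x y, α ω (onIcc T C) x y = alpha (fun z => ν' z ω) C x y := by
  classical
  let good : Ω → Prop := fun ω => ∃ α : VectorMeasure (Icc (0 : ℝ≥0) T × U) (Bil X),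
    ∀ D, MeasurableSet D → α D = bilOf G (fun x => ν x ω) (ofIcc D)
  let α : Ω → VectorMeasure (Icc (0 : ℝ≥0) T × U) (Bil X) := fun ω =>
    if h : good ω then h.choose else 0
  have hα : ∀ᵐ ω ∂P, (∀ x, ν' x ω (Icc 0 T ×ˢ univ) < ∞) ∧
      ∀ D, MeasurableSet D → ∀ x y, α ω D x y = alpha (fun z => ν' z ω) (ofIcc D) x y := by
    filter_upwards [hη, h] with ω h1 ⟨hQ, h2⟩
    have hg : good ω := hQ.exists_vectorMeasure hG h1
    refine ⟨fun x => ?_, fun D hD x y => ?_⟩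
    · rw [h2 x _ (measurableSet_Icc.prod .univ) h1]
      exact ENNReal.ofReal_lt_top
    · have hDη : η ω (ofIcc D) ≠ ∞ := ne_top_of_le_ne_top h1 (measure_mono (ofIcc_subset D))
      simp only [α, dif_pos hg]
      rw [hg.choose_spec D hD]
      exact bilOf_eq_alpha hQ hG hDη (fun x => h2 x _ (measurableSet_ofIcc hD) hDη) x y
  refine ⟨α, fun D hD x y => ?_, ?_⟩
  -- The choice of α ω carries no measurability. Its values agree almost surely with those of
  -- `alpha`, which are measurable, and completeness of P does the rest.
  · have hmeas : Measurable fun ω => alpha (fun z => ν' z ω) (ofIcc D) x y := by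
      have hz : ∀ z, Measurable fun ω => (ν' z ω (ofIcc D)).toReal := fun z =>
        ((Measure.measurable_coe (measurableSet_ofIcc hD)).comp (hν z)).ennreal_toReal
      exact ((hz _).sub (hz _)).div_const 4
    exact hmeas.congr_ae (hα.mono fun ω hω => (hω.2 D hD x y).symm)
  · filter_upwards [hα] with ω hω
    refine ⟨hω.1, fun C hC hCT x y => ?_⟩
    rw [hω.2 _ (measurableSet_onIcc hC), ofIcc_onIcc hCT]

lemma alpha_Ioc_prod {m : StrongDual ℝ X → Measure (ℝ≥0 × U)} {s t : ℝ≥0} (hst : s ≤ t)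
    {A : Set U} (hA : MeasurableSet A) {x y : StrongDual ℝ X}
    (h₁ : m (x + y) (Icc 0 s ×ˢ A) ≠ ∞) (h₂ : m (x - y) (Icc 0 s ×ˢ A) ≠ ∞)
    (h₃ : m (x + y) (Icc 0 t ×ˢ A) ≠ ∞) (h₄ : m (x - y) (Icc 0 t ×ˢ A) ≠ ∞) :
    alpha m (Ioc s t ×ˢ A) x y = alpha m (Icc 0 t ×ˢ A) x y - alpha m (Icc 0 s ×ˢ A) x y := by
  have key : ∀ μ : Measure (ℝ≥0 × U), μ (Icc 0 s ×ˢ A) ≠ ∞ → μ (Icc 0 t ×ˢ A) ≠ ∞ →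
      (μ (Ioc s t ×ˢ A)).toReal = (μ (Icc 0 t ×ˢ A)).toReal - (μ (Icc 0 s ×ˢ A)).toReal := by
    intro μ hs ht
    have hI : Icc (0 : ℝ≥0) t = Icc 0 s ∪ Ioc s t := (Icc_union_Ioc_eq_Icc zero_le hst).symm
    have hd : Disjoint (Icc 0 s ×ˢ A) (Ioc s t ×ˢ A) :=
      disjoint_prod.2 (.inl (disjoint_left.2 fun a ha ha' => ha.2.not_gt ha'.1))
    rw [hI, union_prod, measure_union hd (measurableSet_Ioc.prod hA), ENNReal.toReal_add hs
      (ne_top_of_le_ne_top ht (measure_mono (prod_mono (hI ▸ subset_union_right) subset_rfl)))]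
    ring
  simp only [alpha]
  rw [key _ h₁ h₃, key _ h₂ h₄]
  ring

end Versions

end CylMVM

theorem mainTheorem8 {Ω U X : Type*} [mΩ : MeasurableSpace Ω]
    [TopologicalSpace U] [T2Space U] [MeasurableSpace U] [BorelSpace U] (hU : IsLusin U)
    [NormedAddCommGroup X] [NormedSpace ℝ X] [CompleteSpace X]
    [TopologicalSpace.SeparableSpace (StrongDual ℝ X)]
    (P : Measure Ω) [IsProbabilityMeasure P] [P.IsComplete]
    (𝓕 : Filtration ℝ≥0 mΩ) [𝓕.IsRightContinuous]
    (h𝓕 : ∀ N : Set Ω, P N = 0 → MeasurableSet[𝓕 0] N)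
    (𝒜 : Set (Set U)) (h𝒜 : IsSetRing 𝒜) (h𝒜' : ∀ A ∈ 𝒜, MeasurableSet A)
    (M : ℝ≥0 → Set U → StrongDual ℝ X → Ω → ℝ) (hM : IsCylOrthMartMeasure P 𝓕 𝒜 M)
    (ν : StrongDual ℝ X → Ω → Measure (ℝ≥0 × U))
    (hν : ∀ x, IsIntensity P 𝓕 𝒜 (fun t A => M t A x) (ν x))
    (hseq : SeqBounded P 𝒜 ν)
    (η : Ω → Measure (ℝ≥0 × U)) (hη : IsQuadVar P 𝒜 ν η) :
    ∃ ν' : StrongDual ℝ X → Ω → Measure (ℝ≥0 × U),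
      (∀ x, IsIntensity P 𝓕 𝒜 (fun t A => M t A x) (ν' x)) ∧
      (∀ x, ∀ᵐ ω ∂P, ν' x ω = ν x ω) ∧
      (∀ᵐ ω ∂P, ∀ s t : ℝ≥0, s ≤ t → ∀ A ∈ 𝒜, η ω (Ioc s t ×ˢ A) < ∞ →
        (∀ x, ν' x ω (Ioc s t ×ˢ A) < ∞) ∧
        ∃ B : Bil X, (∀ x y, B x y = alpha (fun z => ν' z ω) (Ioc s t ×ˢ A) x y) ∧
          ‖B‖ₑ ≤ η ω (Ioc s t ×ˢ A)) ∧
      ∀ T : ℝ≥0, 0 < T → (∀ᵐ ω ∂P, (⨆ A ∈ 𝒜, η ω (Icc 0 T ×ˢ A)) < ∞) →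
        ∃ α : Ω → VectorMeasure (Icc (0 : ℝ≥0) T × U) (Bil X),
          (∀ C, MeasurableSet C → ∀ x y, Measurable fun ω => α ω C x y) ∧
          (∀ᵐ ω ∂P, (∀ x, ν' x ω (Icc 0 T ×ˢ univ) < ∞) ∧
            ∀ C : Set (ℝ≥0 × U), MeasurableSet C → C ⊆ Icc 0 T ×ˢ univ →
              ∀ x y, α ω (onIcc T C) x y = alpha (fun z => ν' z ω) C x y) ∧
          ∀ A ∈ 𝒜, ∀ x y,
            (∃ V, IsQuadCov P 𝓕 (fun t => M t A x) (fun t => M t A y) V) ∧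
            ∀ V, IsQuadCov P 𝓕 (fun t => M t A x) (fun t => M t A y) V →
              ∀ s t : ℝ≥0, s ≤ t → t ≤ T →
                ∀ᵐ ω ∂P, α ω (onIcc T (Ioc s t ×ˢ A)) x y = V t ω - V s ω := by
  have := hU.countablyGenerated
  obtain ⟨G, hG, ν', hνν', hν'⟩ := exists_versions hM hν h𝓕 hη
  have hI : ∀ x, IsIntensity P 𝓕 𝒜 (fun t A => M t A x) (ν' x) := fun x =>
    (hν x).congr h𝓕 (hνν' x)
  refine ⟨ν', hI, hνν', ?_, fun T _ hT => ?_⟩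
  · filter_upwards [hν'] with ω ⟨hQ, h⟩ s t _ A hA hη
    have hC : MeasurableSet (Ioc s t ×ˢ A) := measurableSet_Ioc.prod (h𝒜' A hA)
    have h' := fun x => h x _ hC hη.ne
    refine ⟨fun x => (h' x).trans_lt ENNReal.ofReal_lt_top, bilOf G (fun x => ν x ω) _,
      bilOf_eq_alpha hQ hG hη.ne h', ?_⟩
    rw [← ofReal_norm]
    exact ENNReal.ofReal_le_of_le_toReal (hQ.norm_bilOf_le hG hη.ne)
  · obtain ⟨E, hEm, hEU, hE, hE𝒜⟩ := hM.exists_exhaustion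
    obtain ⟨α, hα, hα'⟩ := exists_random_vectorMeasure hG (fun x => (hI x).measurable)
      (hT.mono fun ω => Icc_prod_ne_top_of_iSup hEm hEU fun n => hE𝒜 n _ (hE n) subset_rfl) hν'
    refine ⟨α, hα, hα', fun A hA x y => ?_⟩
    obtain ⟨V₀, hV₀, e₀⟩ := exists_quadCov hM hI hA x y
    refine ⟨⟨V₀, hV₀⟩, fun V hV s t hst htT => ?_⟩
    -- An arbitrary version V of the covariation agrees at the times s and t with the one obtained
    -- by polarizing the brackets.
    have hu := (isQuadCov_iff_isCompensator.1 hV).unique h𝓕 (isQuadCov_iff_isCompensator.1 hV₀)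
    filter_upwards [hα', e₀ s, e₀ t, hu s, hu t] with ω h₁ h₂ h₃ h₄ h₅
    have hsub : Ioc s t ×ˢ A ⊆ Icc (0 : ℝ≥0) T ×ˢ univ :=
      prod_mono (fun r hr => ⟨zero_le, hr.2.trans htT⟩) (subset_univ _)
    rw [h₁.2 _ (measurableSet_Ioc.prod (h𝒜' A hA)) hsub,
      alpha_Ioc_prod hst (h𝒜' A hA) h₂.1 h₂.2.1 h₃.1 h₃.2.1, h₂.2.2, h₃.2.2, h₄, h₅]
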